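/- Let $p$ be an odd prime and let $G$ be a finite metabelian $p$-group of order $p^n$ whose abelianization $G/G'$ is of type $(p,p)$ (that is, $G/G'\cong C_p\times C_p$). Let $\gamma_1(G)=G$, $\gamma_{j+1}(G)=[\gamma_j(G),G]$ be the lower central series, $c$ the nilpotency class of $G$, and $r=n-c$ its coclass; assume $r\ge 2$. For $j\ge 2$ let $\chi_j(G)\ge\gamma_2(G)$ be the largest subgroup of $G$ with $[\chi_j(G),\gamma_j(G)]\le\gamma_{j+2}(G)$. Put $s=\min\{j\ge 2: \chi_j(G)>\gamma_2(G)\}$ and $e=\min\{j\ge 2: \gamma_{j+1}(G)/\gamma_{j+2}(G)\text{ is cyclic}\}$ (the trivial group is cyclic). The defect of commutativity $k(G)$ is the integer $k$ with $0\le k\le c$ and $[\chi_s(G),\gamma_e(G)]=\gamma_{c+1-k}(G)$. Assume that $k(G)=0$. If $p\ge 5$, assume moreover that $G$ has generators $x,y$ with the following properties. Let $s_2=t_2=[y,x]$, $s_j=[s_{j-1},x]$ and $t_j=[t_{j-1},y]$ for $j\ge 3$, $\Sigma_3=\langle s_3,\dots,s_c\rangle$ and $T_3=\langle t_3,\dots,t_{r+2}\rangle$;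 then $[s_3,y]=1$, $t_{r+2}=1$ and $\Sigma_3\cap T_3=1$. (For $p=3$ nothing is assumed beyond $k(G)=0$.) Then the total number of normal subgroups of $G$ is $$1+c+r+p\,(3+cr-c-2r).$$ In particular, for $p=3$ it is $10+3cr-2c-5r$. -/

import Mathlib

open scoped commutatorElement

namespace NormalLattice

variable (G : Type*) [Group G]

/-- The term `γ_j(G)` of the lower central series with the indexing `γ_1(G) = G`,
`γ_{j+1}(G) = [γ_j(G), G]` (Mathlib's series starts at index `0`); only `j ≥ 1` is meaningful. -/
def gam (j : ℕ) : Subgroup G :=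
  (⊤ : Subgroup G).lowerCentralSeries (j - 1)

instance gam_normal (j : ℕ) : (gam G j).Normal := by
  unfold gam; infer_instance

/-- The `j`-th two-step centralizer `χ_j(G)`: the largest subgroup `H` of `G` containing `γ_2(G)`
with `[H, γ_j(G)] ≤ γ_{j+2}(G)`. -/
def chi (j : ℕ) : Subgroup G :=
  sSup {H : Subgroup G | gam G 2 ≤ H ∧ ⁅H, gam G j⁆ ≤ gam G (j + 2)}

theorem chi_commutator_le (j : ℕ) : ⁅chi G j, gam G j⁆ ≤ gam G (j + 2) := by
  have key : chi G j ≤ (Subgroup.centralizer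
      ((gam G j).map (QuotientGroup.mk' (gam G (j + 2))) : Set (G ⧸ gam G (j + 2)))).comap
        (QuotientGroup.mk' (gam G (j + 2))) := by
    refine sSup_le fun H hH => ?_
    rw [← Subgroup.map_le_iff_le_comap, ← Subgroup.commutator_eq_bot_iff_le_centralizer,
      ← Subgroup.map_commutator, Subgroup.map_eq_bot_iff, QuotientGroup.ker_mk']
    exact hH.2
  rw [← Subgroup.map_le_iff_le_comap, ← Subgroup.commutator_eq_bot_iff_le_centralizer,
    ← Subgroup.map_commutator, Subgroup.map_eq_bot_iff, QuotientGroup.ker_mk'] at key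
  exact key

/-- The invariant `s = min {j ≥ 2 | χ_j(G) > γ_2(G)}`. -/
noncomputable def invS : ℕ :=
  sInf {j : ℕ | 2 ≤ j ∧ gam G 2 < chi G j}

/-- The invariant `e = min {j ≥ 2 | γ_{j+1}(G) / γ_{j+2}(G) is cyclic}`
(the trivial group counts as cyclic). -/
noncomputable def invE : ℕ :=
  sInf {j : ℕ | 2 ≤ j ∧ IsCyclic (gam G (j + 1) ⧸ (gam G (j + 2)).subgroupOf (gam G (j + 1)))}

/-- The defect of commutativity `k(G)` is `k`: `[χ_s(G), γ_e(G)] = γ_{c+1-k}(G)`,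
where `c` is the nilpotency class of `G`. -/
def HasDefect (k : ℕ) : Prop :=
  k ≤ Group.nilpotencyClass G ∧
    ⁅chi G (invS G), gam G (invE G)⁆ = gam G (Group.nilpotencyClass G + 1 - k)

variable {G}

/-- `iterComm x y z j` is the higher commutator `u_j` with `u_2 = [y, x]` and
`u_j = [u_{j-1}, z]` for `j ≥ 3`; only `j ≥ 2` is meaningful. Thus `s_j = iterComm x y x j`
and `t_j = iterComm x y y j`. -/
def iterComm (x y z : G) (j : ℕ) : G :=
  (fun u => ⁅u, z⁆)^[j - 2] ⁅y, x⁆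

/-- `Σ_j = ⟨s_j, …, s_c⟩`. -/
def SigmaSub (x y : G) (c j : ℕ) : Subgroup G :=
  Subgroup.closure {g | ∃ i, j ≤ i ∧ i ≤ c ∧ g = iterComm x y x i}

/-- `T_ℓ = ⟨t_ℓ, …, t_{r+2}⟩`. -/
def TSub (x y : G) (r l : ℕ) : Subgroup G :=
  Subgroup.closure {g | ∃ i, l ≤ i ∧ i ≤ r + 2 ∧ g = iterComm x y y i}

/-- Generators `x, y` of `G` satisfying the independence condition `Σ_3 ∩ T_3 = 1` with
`t_{r+2} = 1`, and for which the mixed commutator `[s_3, y]` is trivial. -/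
def IndependentGenerators (x y : G) (c r : ℕ) : Prop :=
  Subgroup.closure {x, y} = ⊤ ∧
    ⁅iterComm x y x 3, y⁆ = 1 ∧
    iterComm x y y (r + 2) = 1 ∧
    SigmaSub x y c 3 ⊓ TSub x y r 3 = ⊥

end NormalLattice

/-! Every element outside G' belongs to a generating pair {x, y}, and G' is the normal closure of
[y,x]. So a normal subgroup not inside G' contains G'. The normal subgroups are thus the p+2
nontrivial subgroups of G/G' together with the submodules of M = G' over Z[G/G'] (`card_normal`). M
is cyclic on s = [y,x]. The kernel of the augmentation mod p acts nilpotently, so M behaves like a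
module over a local ring and every proper submodule lies in the radical γ_3.

Write X = 1-x and Y = 1-y. The aim is to present γ_3 as ⟨u⟩ + ⟨v⟩ with Yu = 0 = Xv, both summands
uniserial, of lengths at most a = c-2 and b = r-1. Comparing orders makes the sum direct and the
lengths exact. A Goursat argument then lists the submodules of γ_3: (a+1)(b+1) sums of layers, and
ab(p-1) diagonals generated by X^i u + κ Y^j v with κ a unit mod p (`pairSubmodule_injective`,
`exists_pairSubmodule_eq`). Adding M itself and the p+2 subgroups above gives the formula.

For p ≠ 3 the given generators allow u = Xs, v = Ys. For p = 3, k(G) = 0 yields some k outside G'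
centralizing γ_e. If e ≤ 3, take y = k and the same u, v. If e ≥ 4, then γ_4/γ_5 is not cyclic, and
a finite computation mod 3 finds generators whose cubes generate γ_3 as a module
(`exists_generators_cubes`); each cube is killed by its own generator. Counting orders gives e ≤
r+1, and the action of k stops one of the two chains within r-1 steps (`dif_smul_eq_zero_or`). -/

namespace NormalLattice

open Submodule

/-! ### Submodules of a uniserial cyclic module. -/

section Uniserial

variable {p : ℕ} [Fact p.Prime] {R M : Type*} [CommRing R] [AddCommGroup M] [Module R M]

/-- Elements of `R` outside the kernel of `π` act invertibly on `M`. -/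
def ActsLocally (π : R →+* ZMod p) (M : Type*) [AddCommGroup M] [Module R M] : Prop :=
  ∀ r : R, π r ≠ 0 → ∃ r' : R, ∀ z : M, r' • r • z = z

/-- The cyclic module generated by `u` is uniserial with layers `X ^ i • u`, of length at
most `a`. -/
structure IsUniserialGen (π : R →+* ZMod p) (X : R) (a : ℕ) (u : M) : Prop where
  smul_mem : ∀ r, π r = 0 → r • u ∈ span R {X • u}
  pow_smul : X ^ a • u = 0

/-- The `i`-th layer of the cyclic module generated by `u`. -/
def layer (X : R) (u : M) (i : ℕ) : Submodule R M := span R {X ^ i • u}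

theorem self_mem_layer (X : R) (u : M) (i : ℕ) : X ^ i • u ∈ layer X u i :=
  mem_span_singleton_self _

theorem layer_antitone (X : R) (u : M) : Antitone (layer X u) := by
  refine antitone_nat_of_succ_le fun i => ?_
  refine (span_singleton_le_iff_mem _ _).2 ?_
  rw [pow_succ', mul_smul]
  exact smul_mem _ _ (self_mem_layer X u i)

namespace IsUniserialGen

variable {π : R →+* ZMod p} {X : R} {a : ℕ} {u : M}

theorem smul_mem_layer (h : IsUniserialGen π X a u) {r : R} (hr : π r = 0) (i : ℕ) :
    r • X ^ i • u ∈ layer X u (i + 1) := by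
  obtain ⟨t, ht⟩ := mem_span_singleton.1 (h.smul_mem r hr)
  rw [smul_comm, ← ht]
  refine mem_span_singleton.2 ⟨t, ?_⟩
  rw [pow_succ, mul_smul, smul_comm t, smul_comm t]

theorem layer_eq_bot (h : IsUniserialGen π X a u) : layer X u a = ⊥ := by
  rw [layer, h.pow_smul, span_zero_singleton]

theorem exists_eq_layer_of_le (h : IsUniserialGen π X a u) (hloc : ActsLocally π M)
    {W : Submodule R M} (hW : W ≤ layer X u 0) : ∃ i ≤ a, W = layer X u i := by
  -- Descend through the layers for as long as `W` fits into the next one; `k` is the number of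
  -- layers left.
  have key : ∀ k i, i + k = a → W ≤ layer X u i → ∃ j ≤ a, W = layer X u j := by
    intro k
    induction k with
    | zero =>
      intro i hi hW
      obtain rfl : i = a := by omega
      exact ⟨i, le_rfl, le_antisymm hW (by rw [h.layer_eq_bot]; exact bot_le)⟩
    | succ k ih =>
      intro i hi hW
      by_cases hW' : W ≤ layer X u (i + 1)
      · exact ih (i + 1) (by omega) hW'
      · refine ⟨i, by omega, le_antisymm hW ?_⟩
        -- An element outside the next layer is a unit multiple of `X ^ i • u`, so it generates the
        -- whole layer.
        obtain ⟨w, hw, hwn⟩ := SetLike.not_le_iff_exists.1 hW'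
        obtain ⟨r, rfl⟩ := mem_span_singleton.1 (hW hw)
        have hr : π r ≠ 0 := fun hr => hwn (h.smul_mem_layer hr i)
        obtain ⟨r', hr'⟩ := hloc r hr
        refine (span_singleton_le_iff_mem _ _).2 ?_
        rw [← hr' (X ^ i • u)]
        exact W.smul_mem _ hw
  exact key a 0 (by omega) hW

variable [Finite M]

/-- Subtracting from a coefficient its residue in 0, …, p-1 moves it into the kernel of `π`, so p
translates of the next layer suffice. -/
theorem card_layer_le (h : IsUniserialGen π X a u) (i : ℕ) :
    Nat.card (layer X u i) ≤ p * Nat.card (layer X u (i + 1)) := by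
  let f : Fin p × layer X u (i + 1) → layer X u i := fun z =>
    ⟨((z.1 : ℕ) : R) • X ^ i • u + z.2, add_mem (Submodule.smul_mem _ _ (self_mem_layer X u i))
      (layer_antitone X u (Nat.le_succ i) z.2.2)⟩
  have hf : Function.Surjective f := by
    rintro ⟨w, hw⟩
    obtain ⟨r, rfl⟩ := mem_span_singleton.1 hw
    have hr : π (r - ((π r).val : R)) = 0 := by simp
    refine ⟨(⟨(π r).val, ZMod.val_lt _⟩, ⟨_, h.smul_mem_layer hr i⟩), ?_⟩
    simp [f, ← add_smul]
  simpa using Nat.card_le_card_of_surjective f hf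

theorem card_layer_le_pow (h : IsUniserialGen π X a u) {i : ℕ} (hi : i ≤ a) :
    Nat.card (layer X u i) ≤ p ^ (a - i) := by
  induction hi using Nat.decreasingInduction with
  | self => simp [h.layer_eq_bot]
  | of_succ k hk ih =>
    refine (h.card_layer_le k).trans ?_
    rw [show a - k = (a - (k + 1)) + 1 by omega, pow_succ']
    exact Nat.mul_le_mul_left _ ih

/-- Each of the `a` steps loses at most a factor p, so order p^a at the top forces every step to
lose exactly p. -/
theorem card_layer (h : IsUniserialGen π X a u) (hc : Nat.card (layer X u 0) = p ^ a)
    {i : ℕ} (hi : i ≤ a) : Nat.card (layer X u i) = p ^ (a - i) := by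
  refine le_antisymm (h.card_layer_le_pow hi) ?_
  have hp : 0 < p := (Fact.out : p.Prime).pos
  have key : ∀ j, p ^ a ≤ p ^ j * Nat.card (layer X u j) := by
    intro j
    induction j with
    | zero => simp [hc]
    | succ j ih =>
      refine ih.trans ?_
      rw [pow_succ, mul_assoc]
      exact Nat.mul_le_mul_left _ (h.card_layer_le j)
  refine Nat.le_of_mul_le_mul_left (c := p ^ i) ?_ (pow_pos hp _)
  rw [← pow_add, Nat.add_sub_cancel' hi]
  exact key i

theorem layer_injOn (h : IsUniserialGen π X a u) (hc : Nat.card (layer X u 0) = p ^ a)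
    {i j : ℕ} (hi : i ≤ a) (hj : j ≤ a) (hij : layer X u i = layer X u j) : i = j := by
  have h1 := h.card_layer hc hi
  rw [hij, h.card_layer hc hj] at h1
  have := Nat.pow_right_injective (Fact.out : p.Prime).two_le h1
  omega

/-- A coefficient acting invertibly would give `X ^ i • u = 0`, collapsing layer i onto layer a. -/
theorem map_eq_zero (h : IsUniserialGen π X a u) (hloc : ActsLocally π M)
    (hc : Nat.card (layer X u 0) = p ^ a) {i : ℕ} (hi : i < a) {r : R}
    (hr : r • X ^ i • u = 0) : π r = 0 := by
  by_contra hr0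
  obtain ⟨r', hr'⟩ := hloc r hr0
  have h0 : X ^ i • u = 0 := by rw [← hr' (X ^ i • u), hr, smul_zero]
  have h1 : layer X u i = layer X u a := by rw [layer, layer, h0, h.pow_smul]
  exact hi.ne (h.layer_injOn hc hi.le le_rfl h1)

end IsUniserialGen

/-- Two independent uniserial cyclic modules on which the uniformizer of the other one acts as
zero. -/
structure UniserialPair (π : R →+* ZMod p) (X Y : R) (a b : ℕ) (u v : M) : Prop where
  left : IsUniserialGen π X a u
  right : IsUniserialGen π Y b v
  smul_left : Y • u = 0
  smul_right : X • v = 0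
  map_left : π X = 0
  map_right : π Y = 0
  loc : ActsLocally π M

/-- The submodules of the sum of a pair of uniserial modules. -/
def pairSubmodule (X Y : R) (a b : ℕ) (u v : M) :
    (Fin (a + 1) × Fin (b + 1)) ⊕ (Fin a × Fin b × (ZMod p)ˣ) → Submodule R M
  | Sum.inl (i, j) => layer X u i ⊔ layer Y v j
  | Sum.inr (i, j, k) =>
      span R {X ^ (i : ℕ) • u + (((k : ZMod p).val : ℕ) : R) • Y ^ (j : ℕ) • v}

/-! ### Submodules of a sum of two uniserial modules. -/

namespace UniserialPair

variable {π : R →+* ZMod p} {X Y : R} {a b : ℕ} {u v : M}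

theorem swap (h : UniserialPair π X Y a b u v) : UniserialPair π Y X b a v u :=
  ⟨h.right, h.left, h.smul_right, h.smul_left, h.map_right, h.map_left, h.loc⟩

theorem smul_eq_zero_left (h : UniserialPair π X Y a b u v) (i : ℕ) : Y • X ^ i • u = 0 := by
  rw [smul_comm, h.smul_left, smul_zero]

variable [Finite M]

omit [Finite M] in
theorem card_sup_mul_card_inf (U V : Submodule R M) :
    Nat.card (U ⊔ V : Submodule R M) * Nat.card (U ⊓ V : Submodule R M) =
      Nat.card U * Nat.card V := by
  have e := LinearMap.quotientInfEquivSupQuotient U V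
  have h1 := Nat.card_congr e.toEquiv
  have h2 := Submodule.card_eq_card_quotient_mul_card ((U ⊓ V).comap U.subtype)
  have h3 := Submodule.card_eq_card_quotient_mul_card (V.comap (U ⊔ V).subtype)
  have h4 : Nat.card ((U ⊓ V).comap U.subtype) = Nat.card (U ⊓ V : Submodule R M) :=
    Nat.card_congr (Submodule.comapSubtypeEquivOfLe inf_le_left).toEquiv
  have h5 : Nat.card (V.comap (U ⊔ V).subtype) = Nat.card V :=
    Nat.card_congr (Submodule.comapSubtypeEquivOfLe le_sup_right).toEquiv
  rw [h4] at h2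
  rw [h5] at h3
  rw [h2, h3, ← h1, ← Submodule.comap_inf]
  ring

variable (hcard : p ^ (a + b) ≤ Nat.card (layer X u 0 ⊔ layer Y v 0 : Submodule R M))
include hcard

/-- The summands have at most p^a and p^b elements, which leaves no slack once the sum has at least
p^(a+b). The same comparison gives `disjoint`. -/
theorem card_left (h : UniserialPair π X Y a b u v) : Nat.card (layer X u 0) = p ^ a := by
  have h1 := card_sup_mul_card_inf (layer X u 0) (layer Y v 0)
  have h2 := h.left.card_layer_le_pow (Nat.zero_le a)
  have h3 := h.right.card_layer_le_pow (Nat.zero_le b)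
  have h4 : 0 < Nat.card (layer X u 0 ⊓ layer Y v 0 : Submodule R M) := Nat.card_pos
  have hp : 0 < p := (Fact.out : p.Prime).pos
  refine le_antisymm h2 ?_
  refine Nat.le_of_mul_le_mul_right (c := p ^ b) ?_ (pow_pos hp _)
  calc p ^ a * p ^ b = p ^ (a + b) := (pow_add _ _ _).symm
    _ ≤ _ := hcard
    _ ≤ _ := Nat.le_mul_of_pos_right _ h4
    _ = _ := h1
    _ ≤ _ := Nat.mul_le_mul_left _ h3

theorem card_right (h : UniserialPair π X Y a b u v) : Nat.card (layer Y v 0) = p ^ b :=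
  h.swap.card_left (by rwa [add_comm, sup_comm])

theorem disjoint (h : UniserialPair π X Y a b u v) : Disjoint (layer X u 0) (layer Y v 0) := by
  have h1 := card_sup_mul_card_inf (layer X u 0) (layer Y v 0)
  rw [h.card_left hcard, h.card_right hcard, ← pow_add] at h1
  have hp : 0 < p ^ (a + b) := pow_pos (Fact.out : p.Prime).pos _
  have h4 : 0 < Nat.card (layer X u 0 ⊓ layer Y v 0 : Submodule R M) := Nat.card_pos
  have h5 : Nat.card (layer X u 0 ⊓ layer Y v 0 : Submodule R M) ≤ 1 := by
    by_contra! h6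
    nlinarith
  rw [disjoint_iff, Submodule.eq_bot_iff]
  intro z hz
  have := (Nat.card_eq_one_iff_unique.1 (le_antisymm h5 h4)).1
  exact congrArg Subtype.val (Subsingleton.elim (⟨z, hz⟩ : (layer X u 0 ⊓ layer Y v 0 :
    Submodule R M)) 0)

theorem eq_zero_of_add (h : UniserialPair π X Y a b u v) {s t : R} {i j : ℕ}
    (hst : s • X ^ i • u + t • Y ^ j • v = 0) : s • X ^ i • u = 0 ∧ t • Y ^ j • v = 0 := by
  have h1 : s • X ^ i • u ∈ layer X u 0 :=
    Submodule.smul_mem _ _ (layer_antitone X u (Nat.zero_le i) (self_mem_layer X u i))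
  have h2 : t • Y ^ j • v ∈ layer Y v 0 :=
    Submodule.smul_mem _ _ (layer_antitone Y v (Nat.zero_le j) (self_mem_layer Y v j))
  have h3 : s • X ^ i • u = 0 := by
    refine Submodule.disjoint_def.1 (h.disjoint hcard) _ h1 ?_
    rw [eq_neg_of_add_eq_zero_left hst]
    exact neg_mem h2
  refine ⟨h3, ?_⟩
  rwa [h3, zero_add] at hst

omit [Finite M] hcard in
-- Adding the whole second summand forgets everything but the first index; injectivity reads that
-- index off from here.
theorem pairSubmodule_sup_right (z : (Fin (a + 1) × Fin (b + 1)) ⊕ (Fin a × Fin b × (ZMod p)ˣ)) :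
    pairSubmodule X Y a b u v z ⊔ layer Y v 0 =
      layer X u (z.elim (fun t => (t.1 : ℕ)) (fun t => (t.1 : ℕ))) ⊔ layer Y v 0 := by
  rcases z with ⟨i, j⟩ | ⟨i, j, k⟩
  · simp only [pairSubmodule, Sum.elim_inl]
    rw [sup_assoc, sup_eq_right.2 (layer_antitone Y v (Nat.zero_le _))]
  · simp only [pairSubmodule, Sum.elim_inr]
    have hv : (((k : ZMod p).val : ℕ) : R) • Y ^ (j : ℕ) • v ∈ layer Y v 0 :=
      Submodule.smul_mem _ _ (layer_antitone Y v (Nat.zero_le _) (self_mem_layer Y v j))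
    refine le_antisymm (sup_le ?_ le_sup_right) (sup_le ?_ le_sup_right)
    · refine (span_singleton_le_iff_mem _ _).2 (add_mem ?_ ?_)
      · exact mem_sup_left (self_mem_layer X u i)
      · exact mem_sup_right hv
    · refine (span_singleton_le_iff_mem _ _).2 ?_
      have := sub_mem (mem_sup_left (mem_span_singleton_self
        (X ^ (i : ℕ) • u + (((k : ZMod p).val : ℕ) : R) • Y ^ (j : ℕ) • v))) (mem_sup_right hv)
      rwa [add_sub_cancel_right] at this

omit [Finite M] hcard in
theorem pairSubmodule_sup_left (h : UniserialPair π X Y a b u v)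
    (z : (Fin (a + 1) × Fin (b + 1)) ⊕ (Fin a × Fin b × (ZMod p)ˣ)) :
    pairSubmodule X Y a b u v z ⊔ layer X u 0 =
      layer Y v (z.elim (fun t => (t.2 : ℕ)) (fun t => (t.2.1 : ℕ))) ⊔ layer X u 0 := by
  rcases z with ⟨i, j⟩ | ⟨i, j, k⟩
  · simp only [pairSubmodule, Sum.elim_inl]
    rw [sup_right_comm, sup_eq_right.2 (layer_antitone X u (Nat.zero_le _)), sup_comm]
  · simp only [pairSubmodule, Sum.elim_inr]
    have hu : X ^ (i : ℕ) • u ∈ layer X u 0 :=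
      layer_antitone X u (Nat.zero_le _) (self_mem_layer X u i)
    refine le_antisymm (sup_le ?_ le_sup_right) (sup_le ?_ le_sup_right)
    · refine (span_singleton_le_iff_mem _ _).2 (add_mem ?_ ?_)
      · exact mem_sup_right hu
      · exact mem_sup_left (Submodule.smul_mem _ _ (self_mem_layer Y v j))
    · refine (span_singleton_le_iff_mem _ _).2 ?_
      -- The diagonal projects onto all of layer j because its coefficient is a unit.
      obtain ⟨r', hr'⟩ := h.loc (((k : ZMod p).val : ℕ) : R) (by simp)
      suffices H : (((k : ZMod p).val : ℕ) : R) • Y ^ (j : ℕ) • v ∈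
          span R {X ^ (i : ℕ) • u + (((k : ZMod p).val : ℕ) : R) • Y ^ (j : ℕ) • v} ⊔
            layer X u 0 by
        have := Submodule.smul_mem _ r' H
        rwa [hr'] at this
      have := sub_mem (mem_sup_left (mem_span_singleton_self
        (X ^ (i : ℕ) • u + (((k : ZMod p).val : ℕ) : R) • Y ^ (j : ℕ) • v))) (mem_sup_right hu)
      rwa [add_sub_cancel_left] at this

omit [Finite M] hcard in
-- The two layers are comparable and meet `V` trivially, so the modular law cancels `V`.
theorem eq_of_sup_eq_of_disjoint {V : Submodule R M} {i j : ℕ}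
    (hU : Antitone (fun n => layer X u n)) (hV : Disjoint (layer X u 0) V)
    (hij : layer X u i ⊔ V = layer X u j ⊔ V) : layer X u i = layer X u j := by
  rcases le_total i j with hle | hle
  · exact (eq_of_le_of_inf_le_of_sup_le (hU hle)
      (by rw [((hV.mono_left (hU (Nat.zero_le i))).eq_bot : layer X u i ⊓ V = ⊥)]; exact bot_le)
      hij.le).symm
  · exact eq_of_le_of_inf_le_of_sup_le (hU hle)
      (by rw [((hV.mono_left (hU (Nat.zero_le j))).eq_bot : layer X u j ⊓ V = ⊥)]; exact bot_le)
      hij.ge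

/-- If r times the generator is the given element, comparing components in the direct sum gives π r
= 1 and π (r t) = π s. -/
theorem map_eq_of_mem (h : UniserialPair π X Y a b u v) {i j : ℕ} (hi : i < a) (hj : j < b)
    {s t : R} (hst : X ^ i • u + s • Y ^ j • v ∈ span R {X ^ i • u + t • Y ^ j • v}) :
    π s = π t := by
  obtain ⟨r, hr⟩ := mem_span_singleton.1 hst
  have h0 : (r - 1) • X ^ i • u + (r * t - s) • Y ^ j • v = 0 := by
    have := sub_eq_zero.2 hr
    rw [← this]
    module
  obtain ⟨h1, h2⟩ := h.eq_zero_of_add hcard h0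
  have h3 := h.left.map_eq_zero h.loc (h.card_left hcard) hi h1
  have h4 := h.right.map_eq_zero h.loc (h.card_right hcard) hj h2
  simp only [map_sub, map_one, map_mul] at h3 h4
  rw [sub_eq_zero] at h3 h4
  rw [← h4, h3, one_mul]

theorem pairSubmodule_injective (h : UniserialPair π X Y a b u v) :
    Function.Injective (pairSubmodule (p := p) X Y a b u v) := by
  intro z z' hz
  have e1 := pairSubmodule_sup_right (X := X) (Y := Y) (u := u) (v := v) z
  rw [hz, pairSubmodule_sup_right] at e1
  have e2 := h.pairSubmodule_sup_left z
  rw [hz, h.pairSubmodule_sup_left] at e2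
  have e1 := eq_of_sup_eq_of_disjoint (layer_antitone X u) (h.disjoint hcard) e1
  have e2 := eq_of_sup_eq_of_disjoint (layer_antitone Y v) (h.disjoint hcard).symm e2
  have b1 : ∀ z : (Fin (a + 1) × Fin (b + 1)) ⊕ (Fin a × Fin b × (ZMod p)ˣ),
      z.elim (fun t => (t.1 : ℕ)) (fun t => (t.1 : ℕ)) ≤ a := by
    rintro (⟨i, j⟩ | ⟨i, j, k⟩)
    · exact Nat.lt_succ_iff.1 i.2
    · exact i.2.le
  have b2 : ∀ z : (Fin (a + 1) × Fin (b + 1)) ⊕ (Fin a × Fin b × (ZMod p)ˣ),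
      z.elim (fun t => (t.2 : ℕ)) (fun t => (t.2.1 : ℕ)) ≤ b := by
    rintro (⟨i, j⟩ | ⟨i, j, k⟩)
    · exact Nat.lt_succ_iff.1 j.2
    · exact j.2.le
  have d1 := h.left.layer_injOn (h.card_left hcard) (b1 _) (b1 _) e1
  have d2 := h.right.layer_injOn (h.card_right hcard) (b2 _) (b2 _) e2
  -- A diagonal is never a sum of layers: containing `X ^ i • u` would make its unit coefficient 0.
  have mixed : ∀ (i : Fin a) (j : Fin b) (k : (ZMod p)ˣ),
      X ^ (i : ℕ) • u ∉ pairSubmodule (p := p) X Y a b u v (Sum.inr (i, j, k)) := by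
    intro i j k hmem
    have := h.map_eq_of_mem hcard i.2 j.2 (s := 0) (t := (((k : ZMod p).val : ℕ) : R))
      (by simpa [pairSubmodule] using hmem)
    simp at this
    exact k.ne_zero this.symm
  rcases z with ⟨i, j⟩ | ⟨i, j, k⟩ <;> rcases z' with ⟨i', j'⟩ | ⟨i', j', k'⟩ <;>
    simp only [Sum.elim_inl, Sum.elim_inr] at d1 d2
  · rw [Fin.ext d1.symm, Fin.ext d2.symm]
  · exfalso
    refine mixed i' j' k' ?_
    rw [← hz, d1]
    exact mem_sup_left (self_mem_layer X u i)
  · exfalso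
    refine mixed i j k ?_
    rw [hz, ← d1]
    exact mem_sup_left (self_mem_layer X u i')
  · obtain rfl := Fin.ext (show (i : ℕ) = i' from d1.symm)
    obtain rfl := Fin.ext (show (j : ℕ) = j' from d2.symm)
    have hmem : X ^ (i : ℕ) • u + (((k : ZMod p).val : ℕ) : R) • Y ^ (j : ℕ) • v ∈
        span R {X ^ (i : ℕ) • u + (((k' : ZMod p).val : ℕ) : R) • Y ^ (j : ℕ) • v} := by
      have : X ^ (i : ℕ) • u + (((k : ZMod p).val : ℕ) : R) • Y ^ (j : ℕ) • v ∈
        pairSubmodule (p := p) X Y a b u v (Sum.inr (i, j, k)) := mem_span_singleton_self _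
      rwa [hz] at this
    have := h.map_eq_of_mem hcard i.2 j.2 hmem
    simp at this
    rw [Units.ext this]

omit [Finite M] hcard in
-- Goursat's argument. The projections of `N` to the summands are layers i and j. Either `N` is
-- their full sum, or it is the graph of an isomorphism of the simple top quotients, which a unit
-- mod p describes.
theorem exists_pairSubmodule_eq (h : UniserialPair π X Y a b u v) {N : Submodule R M}
    (hN : N ≤ layer X u 0 ⊔ layer Y v 0) :
    ∃ z, pairSubmodule (p := p) X Y a b u v z = N := by
  obtain ⟨i, hi, hiU⟩ := h.left.exists_eq_layer_of_le h.loc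
    (W := (N ⊔ layer Y v 0) ⊓ layer X u 0) inf_le_right
  obtain ⟨j, hj, hjV⟩ := h.right.exists_eq_layer_of_le h.loc
    (W := (N ⊔ layer X u 0) ⊓ layer Y v 0) inf_le_right
  have hmem : ∀ s t, s ∈ layer X u 0 → t ∈ layer Y v 0 → s + t ∈ N →
      s ∈ layer X u i ∧ t ∈ layer Y v j := by
    intro s t hs ht hst
    rw [← hiU, ← hjV]
    refine ⟨⟨?_, hs⟩, ⟨?_, ht⟩⟩
    · rw [← add_sub_cancel_right s t]
      exact sub_mem (mem_sup_left hst) (mem_sup_right ht)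
    · rw [← add_sub_cancel_left s t]
      exact sub_mem (mem_sup_left hst) (mem_sup_right hs)
  have hle : N ≤ layer X u i ⊔ layer Y v j := by
    intro n hn
    obtain ⟨s, hs, t, ht, rfl⟩ := mem_sup.1 (hN hn)
    obtain ⟨h1, h2⟩ := hmem s t hs ht hn
    exact add_mem (mem_sup_left h1) (mem_sup_right h2)
  have hz1 : ∃ r : R, X ^ i • u + r • Y ^ j • v ∈ N := by
    have h1 := self_mem_layer X u i
    rw [← hiU] at h1
    obtain ⟨n, hn, t, ht, hnt⟩ := mem_sup.1 h1.1
    have hn' : X ^ i • u + -t ∈ N := by rwa [← hnt, add_neg_cancel_right]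
    obtain ⟨-, h3⟩ := hmem _ (-t) h1.2 (neg_mem ht) hn'
    obtain ⟨r, hr⟩ := mem_span_singleton.1 h3
    exact ⟨r, by rwa [hr]⟩
  have hz2 : ∃ r : R, r • X ^ i • u + Y ^ j • v ∈ N := by
    have h1 := self_mem_layer Y v j
    rw [← hjV] at h1
    obtain ⟨n, hn, t, ht, hnt⟩ := mem_sup.1 h1.1
    have hn' : -t + Y ^ j • v ∈ N := by rwa [← hnt, add_comm n, neg_add_cancel_left]
    obtain ⟨h3, -⟩ := hmem (-t) _ (neg_mem ht) h1.2 hn'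
    obtain ⟨r, hr⟩ := mem_span_singleton.1 h3
    exact ⟨r, by rwa [hr]⟩
  obtain ⟨r, hr⟩ := hz1
  obtain ⟨r₂, hr₂⟩ := hz2
  have full : X ^ i • u ∈ N → Y ^ j • v ∈ N → ∃ z, pairSubmodule (p := p) X Y a b u v z = N := by
    intro h1 h2
    refine ⟨Sum.inl (⟨i, Nat.lt_succ_iff.2 hi⟩, ⟨j, Nat.lt_succ_iff.2 hj⟩), le_antisymm ?_ hle⟩
    exact sup_le ((span_singleton_le_iff_mem _ _).2 h1) ((span_singleton_le_iff_mem _ _).2 h2)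
  rcases hi.eq_or_lt with rfl | hi'
  · rw [h.left.pow_smul, smul_zero, zero_add] at hr₂
    exact full (by rw [h.left.pow_smul]; exact zero_mem _) hr₂
  rcases hj.eq_or_lt with rfl | hj'
  · rw [h.right.pow_smul, smul_zero, add_zero] at hr
    exact full hr (by rw [h.right.pow_smul]; exact zero_mem _)
  -- `Y` kills the first component of the element in `hr₂`, leaving the generator of the next layer.
  have hYv : layer Y v (j + 1) ≤ N := by
    refine (span_singleton_le_iff_mem _ _).2 ?_
    have := N.smul_mem Y hr₂
    rwa [smul_add, smul_comm, h.smul_eq_zero_left, smul_zero, zero_add, ← mul_smul,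
      ← pow_succ'] at this
  by_cases hπ : π r = 0
  · have h1 : X ^ i • u ∈ N := by
      rw [← add_sub_cancel_right (X ^ i • u) (r • Y ^ j • v)]
      exact sub_mem hr (hYv (h.right.smul_mem_layer hπ j))
    refine full h1 ?_
    rw [← add_sub_cancel_left (r₂ • X ^ i • u) (Y ^ j • v)]
    exact sub_mem hr₂ (N.smul_mem _ h1)
  · let k : (ZMod p)ˣ := Units.mk0 (π r) hπ
    have hk : π (((k : ZMod p).val : ℕ) : R) = π r := by simp [k]
    have hzk : X ^ i • u + (((k : ZMod p).val : ℕ) : R) • Y ^ j • v ∈ N := by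
      have h1 : ((((k : ZMod p).val : ℕ) : R) - r) • Y ^ j • v ∈ N :=
        hYv (h.right.smul_mem_layer (by rw [map_sub, hk, sub_self]) j)
      have := add_mem hr h1
      convert this using 1
      module
    -- If `N` exceeds the diagonal, subtracting a multiple of the diagonal generator from an extra
    -- element leaves a unit multiple of `Y ^ j • v`, so `N` is the full sum.
    by_cases hs : pairSubmodule (p := p) X Y a b u v (Sum.inr (⟨i, hi'⟩, ⟨j, hj'⟩, k)) = N
    · exact ⟨_, hs⟩
    have hsle : pairSubmodule (p := p) X Y a b u v (Sum.inr (⟨i, hi'⟩, ⟨j, hj'⟩, k)) ≤ N :=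
      (span_singleton_le_iff_mem _ _).2 hzk
    obtain ⟨n, hn, hns⟩ := SetLike.not_le_iff_exists.1 (fun h' => hs (le_antisymm hsle h'))
    obtain ⟨s, hs, t, ht, rfl⟩ := mem_sup.1 (hle hn)
    obtain ⟨α, rfl⟩ := mem_span_singleton.1 hs
    obtain ⟨β, rfl⟩ := mem_span_singleton.1 ht
    set κ : R := (((k : ZMod p).val : ℕ) : R) with hκ
    have hzself : X ^ i • u + κ • Y ^ j • v ∈
        pairSubmodule (p := p) X Y a b u v (Sum.inr (⟨i, hi'⟩, ⟨j, hj'⟩, k)) :=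
      mem_span_singleton_self _
    have hdiff : α • X ^ i • u + β • Y ^ j • v =
        α • (X ^ i • u + κ • Y ^ j • v) + (β - α * κ) • Y ^ j • v := by module
    have hYs : layer Y v (j + 1) ≤
        pairSubmodule (p := p) X Y a b u v (Sum.inr (⟨i, hi'⟩, ⟨j, hj'⟩, k)) := by
      refine (span_singleton_le_iff_mem _ _).2 ?_
      obtain ⟨κ', hκ'⟩ := h.loc κ (by rw [hk]; exact hπ)
      have h1 := Submodule.smul_mem _ (κ' * Y) hzself
      have h2 : (κ' * Y) • (X ^ i • u + κ • Y ^ j • v) = Y ^ (j + 1) • v := by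
        rw [smul_add, mul_smul, h.smul_eq_zero_left, smul_zero, zero_add, mul_smul,
          smul_comm Y κ, hκ', ← mul_smul, ← pow_succ']
      rwa [h2] at h1
    have hπ' : π (β - α * κ) ≠ 0 := by
      intro h0
      refine hns ?_
      rw [hdiff]
      exact add_mem (Submodule.smul_mem _ _ hzself) (hYs (h.right.smul_mem_layer h0 j))
    obtain ⟨ρ, hρ⟩ := h.loc _ hπ'
    have h1 : (β - α * κ) • Y ^ j • v ∈ N := by
      have := sub_mem hn (N.smul_mem α hzk)
      rwa [hdiff, add_sub_cancel_left] at this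
    have h2 : Y ^ j • v ∈ N := by
      rw [← hρ (Y ^ j • v)]
      exact N.smul_mem _ h1
    refine full ?_ h2
    rw [← add_sub_cancel_right (X ^ i • u) (κ • Y ^ j • v)]
    exact sub_mem hzk (N.smul_mem _ h2)

omit hcard in
/-- The number of submodules of a module generated by `s`, whose radical is the sum of a
uniserial pair. -/
theorem card_submodule (h : UniserialPair π X Y a b u v) {s : M} (hs : span R {s} = ⊤)
    (hrad : ∀ r, π r = 0 → r • s ∈ layer X u 0 ⊔ layer Y v 0)
    (hne : layer X u 0 ⊔ layer Y v 0 ≠ ⊤)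
    (hM : p ^ (a + b + 1) ≤ Nat.card M) :
    Nat.card (Submodule R M) = 1 + (a + 1) * (b + 1) + a * b * (p - 1) := by
  have hp : 0 < p := (Fact.out : p.Prime).pos
  set D : Submodule R M := layer X u 0 ⊔ layer Y v 0 with hD
  -- Reducing coefficients of `s` to residues mod p covers the module by p translates of `D`.
  have hcard : p ^ (a + b) ≤ Nat.card D := by
    let f : Fin p × D → M := fun z => ((z.1 : ℕ) : R) • s + z.2
    have hf : Function.Surjective f := by
      intro w
      obtain ⟨r, rfl⟩ := mem_span_singleton.1 (hs ▸ mem_top : w ∈ span R {s})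
      have hr : π (r - ((π r).val : R)) = 0 := by simp
      refine ⟨(⟨(π r).val, ZMod.val_lt _⟩, ⟨_, hrad _ hr⟩), ?_⟩
      simp [f, ← add_smul]
    have h1 := Nat.card_le_card_of_surjective f hf
    rw [Nat.card_prod, Nat.card_fin] at h1
    refine Nat.le_of_mul_le_mul_left (c := p) ?_ hp
    rw [← pow_succ']
    exact hM.trans h1
  -- `none` stands for the whole module, the only submodule not inside `D`.
  let F : Option ((Fin (a + 1) × Fin (b + 1)) ⊕ (Fin a × Fin b × (ZMod p)ˣ)) → Submodule R M :=
    fun z => z.elim ⊤ (pairSubmodule X Y a b u v)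
  have hFD : ∀ z, pairSubmodule (p := p) X Y a b u v z ≤ D := by
    rintro (⟨i, j⟩ | ⟨i, j, k⟩)
    · exact sup_le_sup (layer_antitone X u (Nat.zero_le _)) (layer_antitone Y v (Nat.zero_le _))
    · refine (span_singleton_le_iff_mem _ _).2 (add_mem ?_ ?_)
      · exact mem_sup_left (layer_antitone X u (Nat.zero_le _) (self_mem_layer X u i))
      · exact mem_sup_right (Submodule.smul_mem _ _
          (layer_antitone Y v (Nat.zero_le _) (self_mem_layer Y v j)))
  have hF : Function.Bijective F := by
    constructor
    · rintro (_ | z) (_ | z') hz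
      · rfl
      · exact absurd (top_le_iff.1 ((show ⊤ = pairSubmodule X Y a b u v z' from hz).le.trans
          (hFD z'))) hne
      · exact absurd (top_le_iff.1 ((show pairSubmodule X Y a b u v z = ⊤ from hz).ge.trans
          (hFD z))) hne
      · exact congrArg some (h.pairSubmodule_injective hcard hz)
    · intro N
      by_cases hN : N ≤ D
      · obtain ⟨z, hz⟩ := h.exists_pairSubmodule_eq hN
        exact ⟨some z, hz⟩
      · refine ⟨none, ?_⟩
        obtain ⟨n, hn, hnD⟩ := SetLike.not_le_iff_exists.1 hN
        obtain ⟨r, rfl⟩ := mem_span_singleton.1 (hs ▸ mem_top : n ∈ span R {s})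
        have hr : π r ≠ 0 := fun hr => hnD (hrad r hr)
        obtain ⟨r', hr'⟩ := h.loc r hr
        refine (top_le_iff.1 ?_).symm
        rw [← hs]
        refine (span_singleton_le_iff_mem _ _).2 ?_
        rw [← hr' s]
        exact N.smul_mem _ hn
  rw [← Nat.card_congr (Equiv.ofBijective F hF)]
  simp only [Nat.card_eq_fintype_card, Fintype.card_option, Fintype.card_sum, Fintype.card_prod,
    Fintype.card_fin, ZMod.card_units]
  ring

end UniserialPair

end Uniserial

end NormalLattice

namespace NormalLattice

open Submodule

/-! ### The commutator subgroup as a module over Z[G/G']. -/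

section DerivedModule

variable (G : Type*) [Group G]

/-- The integral group ring of the abelianization. -/
abbrev AbGroupRing : Type _ := MonoidAlgebra ℤ (Abelianization G)

/-- The commutator subgroup of a metabelian group, written additively. -/
def DerivedModule : Type _ := Additive (commutator G)

variable {G}

/-- The image of a group element in the group ring of the abelianization. -/
noncomputable def grp (g : G) : AbGroupRing G :=
  MonoidAlgebra.of ℤ (Abelianization G) (Abelianization.of g)

theorem grp_mul (g h : G) : grp (g * h) = grp g * grp h := by simp [grp]

theorem grp_one : grp (1 : G) = 1 := by simp [grp, MonoidAlgebra.one_def]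

theorem grp_pow (g : G) (n : ℕ) : grp (g ^ n) = grp g ^ n := by
  induction n with
  | zero => simp [grp_one]
  | succ n ih => rw [pow_succ, pow_succ, grp_mul, ih]

theorem grp_of_mem {g : G} (hg : g ∈ commutator G) : grp g = 1 := by
  rw [← Abelianization.ker_of] at hg
  rw [grp, MonoidHom.mem_ker.1 hg, map_one]

/-- The element `1 - g` of the group ring; it acts on the commutator subgroup as `a ↦ ⁅a, g⁆`. -/
noncomputable def dif (g : G) : AbGroupRing G := 1 - grp g

theorem dif_mul (g h : G) : dif (g * h) = dif g + grp g * dif h := by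
  simp only [dif, grp_mul]; ring

/-- The augmentation modulo `p`. -/
noncomputable def aug (p : ℕ) : AbGroupRing G →+* ZMod p :=
  (MonoidAlgebra.lift ℤ (ZMod p) (Abelianization G) 1 : AbGroupRing G →ₐ[ℤ] ZMod p).toRingHom

theorem aug_grp (p : ℕ) (g : G) : aug p (grp g) = 1 := by
  simp [aug, grp]

theorem aug_dif (p : ℕ) (g : G) : aug p (dif g) = 0 := by
  simp [dif, aug_grp]

variable (G) in
/-- The augmentation ideal. -/
noncomputable def augIdeal : Ideal (AbGroupRing G) := Ideal.span (Set.range dif)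

theorem dif_mem (g : G) : dif g ∈ augIdeal G := Ideal.subset_span ⟨g, rfl⟩

theorem aug_eq_zero_of_mem (p : ℕ) {r : AbGroupRing G} (hr : r ∈ augIdeal G) : aug p r = 0 := by
  have : augIdeal G ≤ RingHom.ker (aug p) := by
    refine Ideal.span_le.2 ?_
    rintro _ ⟨g, rfl⟩
    exact aug_dif p g
  exact this hr

theorem exists_int_sub_mem (r : AbGroupRing G) : ∃ n : ℤ, r - n ∈ augIdeal G := by
  induction r using MonoidAlgebra.induction_on with
  | of g =>
    obtain ⟨g, rfl⟩ := QuotientGroup.mk_surjective g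
    refine ⟨1, ?_⟩
    rw [← neg_mem_iff, neg_sub, Int.cast_one]
    exact dif_mem g
  | add r s hr hs =>
    obtain ⟨m, hm⟩ := hr
    obtain ⟨n, hn⟩ := hs
    refine ⟨m + n, ?_⟩
    push_cast
    rw [add_sub_add_comm]
    exact add_mem hm hn
  | smul k r hr =>
    obtain ⟨m, hm⟩ := hr
    refine ⟨k * m, ?_⟩
    push_cast
    rw [zsmul_eq_mul, ← mul_sub]
    exact Ideal.mul_mem_left _ _ hm

/-- `dif` is a crossed homomorphism (`dif_mul`), so its values lie in the ideal generated by those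
on generators. -/
theorem augIdeal_eq_span {x y : G} (hxy : Subgroup.closure {x, y} = ⊤) :
    augIdeal G = Ideal.span {dif x, dif y} := by
  refine le_antisymm (Ideal.span_le.2 ?_) (Ideal.span_le.2 ?_)
  · rintro _ ⟨g, rfl⟩
    have hg : g ∈ Subgroup.closure {x, y} := hxy ▸ Subgroup.mem_top g
    induction hg using Subgroup.closure_induction with
    | mem g hg =>
      rcases hg with rfl | rfl
      · exact Ideal.subset_span (by simp)
      · exact Ideal.subset_span (by simp)
    | one => simp [dif, grp_one]
    | mul g h _ _ hg hh =>
      rw [dif_mul]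
      exact add_mem hg (Ideal.mul_mem_left _ _ hh)
    | inv g _ hg =>
      have h1 : dif g⁻¹ = - (grp g⁻¹ * dif g) := by
        rw [dif, dif, mul_sub, ← grp_mul, inv_mul_cancel, grp_one]; ring
      rw [h1]
      exact neg_mem (Ideal.mul_mem_left _ _ hg)
  · rintro _ (rfl | rfl)
    · exact dif_mem _
    · exact dif_mem _

variable [IsMulCommutative (commutator G)]

instance : AddGroup (DerivedModule G) := inferInstanceAs (AddGroup (Additive (commutator G)))

instance : AddCommGroup (DerivedModule G) :=
  { (inferInstance : AddGroup (DerivedModule G)) with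
    add_comm := fun a b => congrArg Additive.ofMul
      (Subtype.ext (setLike_mul_comm (Additive.toMul a : commutator G).2
        (Additive.toMul b : commutator G).2)) }

/-- The inclusion of the derived module into the group. -/
def DerivedModule.val (z : DerivedModule G) : G := ((Additive.toMul z : commutator G) : G)

namespace DerivedModule

omit [IsMulCommutative (commutator G)] in
theorem val_mem (z : DerivedModule G) : z.val ∈ commutator G :=
  (Additive.toMul z : commutator G).2

omit [IsMulCommutative (commutator G)] in
theorem val_injective : Function.Injective (val : DerivedModule G → G) := Subtype.val_injective

/-- The element of the derived module given by an element of the commutator subgroup. -/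
def mk (g : G) (hg : g ∈ commutator G) : DerivedModule G := Additive.ofMul ⟨g, hg⟩

omit [IsMulCommutative (commutator G)] in
@[simp] theorem val_mk (g : G) (hg : g ∈ commutator G) : (mk g hg).val = g := rfl

@[simp] theorem val_add (z w : DerivedModule G) : (z + w).val = z.val * w.val := rfl

@[simp] theorem val_zero : (0 : DerivedModule G).val = 1 := rfl

@[simp] theorem val_neg (z : DerivedModule G) : (-z).val = z.val⁻¹ := rfl

variable (G) in
/-- The conjugation action on the derived module. -/
noncomputable def conj : G →* Module.End ℤ (DerivedModule G) where
  toFun g := ((MulAut.conjNormal g : commutator G ≃* commutator G).toMonoidHom.toAdditive :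
    DerivedModule G →+ DerivedModule G).toIntLinearMap
  map_one' := by
    ext z
    apply val_injective
    change ((MulAut.conjNormal (1 : G) (Additive.toMul z : commutator G) : commutator G) : G) =
      z.val
    rw [map_one]
    rfl
  map_mul' g h := by
    ext z
    apply val_injective
    change ((MulAut.conjNormal (g * h) (Additive.toMul z : commutator G) : commutator G) : G) =
      ((MulAut.conjNormal g (MulAut.conjNormal h (Additive.toMul z : commutator G)) :
        commutator G) : G)
    rw [map_mul]
    rfl

theorem val_conj (g : G) (z : DerivedModule G) : (conj G g z).val = g * z.val * g⁻¹ :=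
  MulAut.conjNormal_apply g _

theorem comm_of_mem {a b : G} (ha : a ∈ commutator G) (hb : b ∈ commutator G) : a * b = b * a :=
  setLike_mul_comm ha hb

variable (G) in
/-- The action of the abelianization on the derived module. -/
noncomputable def abConj : Abelianization G →* Module.End ℤ (DerivedModule G) :=
  QuotientGroup.lift (commutator G) (conj G) (by
    intro g hg
    ext z
    apply val_injective
    rw [val_conj, comm_of_mem hg z.val_mem, mul_inv_cancel_right]
    rfl)

noncomputable instance : Module (AbGroupRing G) (DerivedModule G) :=
  Module.compHom (DerivedModule G)
    (MonoidAlgebra.lift ℤ (Module.End ℤ (DerivedModule G)) (Abelianization G)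
      (abConj G)).toRingHom

@[simp] theorem val_grp_smul (g : G) (z : DerivedModule G) :
    (grp g • z).val = g * z.val * g⁻¹ := by
  rw [← val_conj]
  change ((MonoidAlgebra.lift ℤ (Module.End ℤ (DerivedModule G)) (Abelianization G)
      (abConj G)) (grp g) z).val = _
  rw [grp, MonoidAlgebra.lift_of]
  rfl

theorem val_dif_smul (g : G) (z : DerivedModule G) : (dif g • z).val = ⁅z.val, g⁆ := by
  rw [dif, sub_smul, one_smul, sub_eq_add_neg, val_add, val_neg, val_grp_smul, commutatorElement_def]
  group

/-- The subgroup of `G` given by a submodule of the derived module. -/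
def toSubgroup (N : Submodule (AbGroupRing G) (DerivedModule G)) : Subgroup G where
  carrier := {g | ∃ z ∈ N, z.val = g}
  mul_mem' := by
    rintro _ _ ⟨z, hz, rfl⟩ ⟨w, hw, rfl⟩
    exact ⟨z + w, add_mem hz hw, rfl⟩
  one_mem' := ⟨0, zero_mem _, rfl⟩
  inv_mem' := by
    rintro _ ⟨z, hz, rfl⟩
    exact ⟨-z, neg_mem hz, rfl⟩

theorem val_mem_toSubgroup {N : Submodule (AbGroupRing G) (DerivedModule G)}
    {z : DerivedModule G} : z.val ∈ toSubgroup N ↔ z ∈ N := by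
  constructor
  · rintro ⟨w, hw, hwz⟩
    rwa [← val_injective hwz]
  · exact fun hz => ⟨z, hz, rfl⟩

theorem toSubgroup_injective :
    Function.Injective (toSubgroup : Submodule (AbGroupRing G) (DerivedModule G) → Subgroup G) := by
  intro N N' h
  ext z
  rw [← val_mem_toSubgroup, h, val_mem_toSubgroup]

theorem toSubgroup_le (N : Submodule (AbGroupRing G) (DerivedModule G)) :
    toSubgroup N ≤ commutator G := by
  rintro _ ⟨z, -, rfl⟩
  exact z.val_mem

theorem toSubgroup_normal (N : Submodule (AbGroupRing G) (DerivedModule G)) :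
    (toSubgroup N).Normal := by
  constructor
  rintro _ ⟨z, hz, rfl⟩ g
  exact ⟨grp g • z, N.smul_mem _ hz, val_grp_smul g z⟩

theorem exists_toSubgroup_eq {H : Subgroup G} (hH : H.Normal) (hle : H ≤ commutator G) :
    ∃ N, toSubgroup N = H := by
  let N : Submodule (AbGroupRing G) (DerivedModule G) :=
    { carrier := {z | z.val ∈ H}
      add_mem' := fun {z w} hz hw => H.mul_mem hz hw
      zero_mem' := H.one_mem
      smul_mem' := by
        intro r z hz
        induction r using MonoidAlgebra.induction_on with
        | of g =>
          obtain ⟨g, rfl⟩ := QuotientGroup.mk_surjective g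
          change (grp g • z).val ∈ H
          rw [val_grp_smul]
          exact hH.conj_mem _ hz g
        | add r s hr hs =>
          change ((r + s) • z).val ∈ H
          rw [add_smul]
          exact H.mul_mem hr hs
        | smul k r hr =>
          let K : AddSubgroup (DerivedModule G) :=
            { carrier := {z | z.val ∈ H}
              add_mem' := fun {z w} hz hw => H.mul_mem hz hw
              zero_mem' := H.one_mem
              neg_mem' := fun {z} hz => H.inv_mem hz }
          change (k • r) • z ∈ K
          rw [smul_assoc]
          exact K.zsmul_mem hr k }
  refine ⟨N, le_antisymm ?_ fun g hg => ⟨mk g (hle hg), hg, rfl⟩⟩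
  rintro _ ⟨z, hz, rfl⟩
  exact hz

theorem commutator_mem_toSubgroup {N : Submodule (AbGroupRing G) (DerivedModule G)} {g : G}
    {z : DerivedModule G} : ⁅z.val, g⁆ ∈ toSubgroup N ↔ dif g • z ∈ N := by
  rw [← val_dif_smul, val_mem_toSubgroup]

/-- Acting by 1-g is forming the commutator with g. This identifies the augmentation filtration with
the lower central series, `fil G k` being γ_{k+2}. -/
theorem toSubgroup_augIdeal_smul (N : Submodule (AbGroupRing G) (DerivedModule G)) :
    toSubgroup (augIdeal G • N) = ⁅toSubgroup N, (⊤ : Subgroup G)⁆ := by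
  refine le_antisymm ?_ ?_
  · have hn : (⁅toSubgroup N, (⊤ : Subgroup G)⁆).Normal := by
      have := toSubgroup_normal N
      infer_instance
    have hle : ⁅toSubgroup N, (⊤ : Subgroup G)⁆ ≤ commutator G :=
      Subgroup.commutator_mono le_top le_rfl
    obtain ⟨N', hN'⟩ := exists_toSubgroup_eq hn hle
    rw [← hN']
    rintro _ ⟨z, hz, rfl⟩
    rw [val_mem_toSubgroup]
    refine (?_ : augIdeal G • N ≤ N') hz
    rw [augIdeal, Submodule.span_smul_eq, Submodule.set_smul_le_iff]
    rintro _ w ⟨g, rfl⟩ hw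
    rw [← commutator_mem_toSubgroup, hN']
    exact Subgroup.commutator_mem_commutator (val_mem_toSubgroup.2 hw) (Subgroup.mem_top g)
  · rw [Subgroup.commutator_le]
    rintro _ ⟨z, hz, rfl⟩ g -
    rw [commutator_mem_toSubgroup]
    exact smul_mem_smul (dif_mem g) hz

theorem toSubgroup_top : toSubgroup (⊤ : Submodule (AbGroupRing G) (DerivedModule G)) =
    commutator G :=
  le_antisymm (toSubgroup_le _) fun g hg => ⟨mk g hg, mem_top, rfl⟩

variable (G) in
/-- The `k`-th term of the augmentation filtration of the derived module. -/
noncomputable def fil (k : ℕ) : Submodule (AbGroupRing G) (DerivedModule G) :=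
  augIdeal G ^ k • ⊤

theorem fil_zero : fil G 0 = ⊤ := by simp [fil]

theorem fil_succ (k : ℕ) : fil G (k + 1) = augIdeal G • fil G k := by
  rw [fil, fil, pow_succ', ← smul_eq_mul, Submodule.smul_assoc]

theorem toSubgroup_fil (k : ℕ) : toSubgroup (fil G k) = gam G (k + 2) := by
  induction k with
  | zero => rw [fil_zero, toSubgroup_top]; rfl
  | succ k ih => rw [fil_succ, toSubgroup_augIdeal_smul, ih]; rfl

theorem fil_antitone : Antitone (fil G) :=
  antitone_nat_of_succ_le fun k => by rw [fil_succ]; exact smul_le_right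

theorem dif_smul_mem_fil (g : G) {k : ℕ} {z : DerivedModule G} (hz : z ∈ fil G k) :
    dif g • z ∈ fil G (k + 1) := by
  rw [fil_succ]
  exact smul_mem_smul (dif_mem g) hz

/-- The commutator of two elements, as an element of the derived module. -/
def comm (g h : G) : DerivedModule G :=
  mk ⁅g, h⁆ (Subgroup.commutator_mem_commutator (Subgroup.mem_top g) (Subgroup.mem_top h))

omit [IsMulCommutative (commutator G)] in
@[simp] theorem val_comm (g h : G) : (comm g h).val = ⁅g, h⁆ := rfl

theorem comm_swap (g h : G) : comm g h = - comm h g :=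
  val_injective (commutatorElement_inv h g).symm

omit [IsMulCommutative (commutator G)] in
-- Modulo `H` the two generators commute, so the quotient is abelian.
theorem commutator_le_of_mem {x y : G} (hxy : Subgroup.closure {x, y} = ⊤) {H : Subgroup G}
    (hH : H.Normal) (h : ⁅y, x⁆ ∈ H) : commutator G ≤ H := by
  have hcomm : Commute (QuotientGroup.mk' H x) (QuotientGroup.mk' H y) := by
    have : QuotientGroup.mk' H ⁅y, x⁆ = 1 := (QuotientGroup.eq_one_iff _).2 h
    rw [map_commutatorElement, commutatorElement_eq_one_iff_commute] at this
    exact this.symm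
  have hcl : Subgroup.closure {QuotientGroup.mk' H x, QuotientGroup.mk' H y} = ⊤ := by
    rw [← Set.image_pair, ← MonoidHom.map_closure, hxy, ← MonoidHom.range_eq_map,
      MonoidHom.range_eq_top]
    exact QuotientGroup.mk'_surjective H
  have hc : ∀ a ∈ ({QuotientGroup.mk' H x, QuotientGroup.mk' H y} : Set (G ⧸ H)),
      ∀ b ∈ ({QuotientGroup.mk' H x, QuotientGroup.mk' H y} : Set (G ⧸ H)), a * b = b * a := by
    rintro a (rfl | rfl) b (rfl | rfl)
    · rfl
    · exact hcomm
    · exact hcomm.symm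
    · rfl
  have hall : ∀ a b : G ⧸ H, a * b = b * a := by
    intro a b
    have ha : a ∈ Subgroup.closure _ := hcl ▸ Subgroup.mem_top a
    have hb : b ∈ Subgroup.closure _ := hcl ▸ Subgroup.mem_top b
    have := Subgroup.isMulCommutative_closure hc
    exact setLike_mul_comm ha hb
  rw [commutator_def, Subgroup.commutator_le]
  intro g _ k _
  rw [← QuotientGroup.eq_one_iff]
  change QuotientGroup.mk' H ⁅g, k⁆ = 1
  rw [map_commutatorElement, commutatorElement_eq_one_iff_mul_comm]
  exact hall _ _

theorem span_comm {x y : G} (hxy : Subgroup.closure {x, y} = ⊤) :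
    span (AbGroupRing G) {comm y x} = ⊤ := by
  apply toSubgroup_injective
  rw [toSubgroup_top]
  refine le_antisymm (toSubgroup_le _) ?_
  exact commutator_le_of_mem hxy (toSubgroup_normal _)
    (val_mem_toSubgroup.2 (mem_span_singleton_self (comm y x)))

omit [IsMulCommutative (commutator G)] in
theorem card_eq : Nat.card (DerivedModule G) = Nat.card (commutator G) := rfl

end DerivedModule

end DerivedModule

end NormalLattice

namespace NormalLattice

open Submodule

/-! ### Relations from p-th powers, and local behaviour of the module. -/

namespace DerivedModule

variable {G : Type*} [Group G] [IsMulCommutative (commutator G)]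

theorem comm_mul_left (a b h : G) : comm (a * b) h = grp a • comm b h + comm a h := by
  apply val_injective
  simp only [val_comm, val_add, val_grp_smul, commutatorElement_def]
  group

theorem comm_one_left (h : G) : comm 1 h = 0 := by
  apply val_injective
  simp

theorem comm_pow_left (g h : G) (n : ℕ) :
    comm (g ^ n) h = (∑ i ∈ Finset.range n, grp g ^ i) • comm g h := by
  induction n with
  | zero => simp [comm_one_left]
  | succ n ih =>
    rw [pow_succ', comm_mul_left, ih, Finset.sum_range_succ', add_smul, pow_zero, one_smul,
      ← mul_smul, Finset.mul_sum]
    simp only [pow_succ']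

theorem dif_smul_mk {a : G} (ha : a ∈ commutator G) (h : G) : dif h • mk a ha = comm a h :=
  val_injective (by rw [val_dif_smul, val_mk, val_comm])

theorem geom_sum_eq {R : Type*} [CommRing R] (t : R) (n : ℕ) :
    ∃ q, ∑ i ∈ Finset.range n, t ^ i = n - (1 - t) * q := by
  induction n with
  | zero => exact ⟨0, by simp⟩
  | succ n ih =>
    obtain ⟨q, hq⟩ := ih
    refine ⟨q + ∑ i ∈ Finset.range n, t ^ i, ?_⟩
    have := mul_neg_geom_sum t n
    rw [Finset.sum_range_succ, mul_add, this, hq]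
    push_cast
    ring

variable {p : ℕ}

/-- The `p`-th power of a group element, as an element of the derived module. -/
def pw (hexp : ∀ g : G, g ^ p ∈ commutator G) (g : G) : DerivedModule G := mk (g ^ p) (hexp g)

theorem dif_smul_pw_self (hexp : ∀ g : G, g ^ p ∈ commutator G) (g : G) :
    dif g • pw hexp g = 0 := by
  rw [pw, dif_smul_mk]
  apply val_injective
  rw [val_comm, val_zero, commutatorElement_eq_one_iff_commute]
  exact (Commute.refl g).pow_left p

/-- The trace relation: [g^p, h] is computed by expanding the power, and again as 1-h acting on g^p
in G'. -/
theorem geom_sum_smul_comm (hexp : ∀ g : G, g ^ p ∈ commutator G) (g h : G) :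
    (∑ i ∈ Finset.range p, grp g ^ i) • comm g h = dif h • pw hexp g := by
  rw [← comm_pow_left, pw, dif_smul_mk]

omit [IsMulCommutative (commutator G)] in
-- As g^p lies in G', 1 - g^p vanishes in the group ring; it factors as (1-g)(p - (1-g)q).
theorem exists_natCast_mul_dif (hexp : ∀ g : G, g ^ p ∈ commutator G) (g : G) :
    ∃ q, (p : AbGroupRing G) * dif g = q * dif g * dif g := by
  obtain ⟨q, hq⟩ := geom_sum_eq (grp g) p
  have h1 := mul_neg_geom_sum (grp g) p
  rw [← grp_pow, grp_of_mem (hexp g), sub_self, hq] at h1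
  refine ⟨q, ?_⟩
  rw [dif]
  linear_combination h1

theorem natCast_smul_mem_fil_one (hexp : ∀ g : G, g ^ p ∈ commutator G) {x y : G}
    (hxy : Subgroup.closure {x, y} = ⊤) (z : DerivedModule G) :
    (p : AbGroupRing G) • z ∈ fil G 1 := by
  obtain ⟨r, rfl⟩ := mem_span_singleton.1 (span_comm hxy ▸ mem_top : z ∈ span _ {comm y x})
  rw [smul_comm]
  refine Submodule.smul_mem _ _ ?_
  obtain ⟨q, hq⟩ := geom_sum_eq (grp y) p
  have h1 := geom_sum_smul_comm hexp y x
  rw [hq, sub_smul, sub_eq_iff_eq_add] at h1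
  have h0 : ∀ w : DerivedModule G, w ∈ fil G 0 := fun w => by rw [fil_zero]; exact mem_top
  rw [h1]
  refine add_mem (dif_smul_mem_fil x (h0 _)) ?_
  rw [mul_smul]
  exact dif_smul_mem_fil y (h0 _)

theorem natCast_smul_mem_fil (hp1 : ∀ z : DerivedModule G, (p : AbGroupRing G) • z ∈ fil G 1)
    {k : ℕ} {z : DerivedModule G} (hz : z ∈ fil G k) :
    (p : AbGroupRing G) • z ∈ fil G (k + 1) := by
  induction k generalizing z with
  | zero => exact hp1 z
  | succ k ih =>
    rw [fil_succ] at hz ⊢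
    induction hz using smul_induction_on' with
    | smul r hr w hw =>
      rw [smul_comm]
      exact smul_mem_smul hr (ih hw)
    | add w hw w' hw' h1 h2 =>
      rw [smul_add]
      exact add_mem h1 h2

omit [IsMulCommutative (commutator G)] in
theorem exists_eq_of_aug_eq_zero {x y : G} (hxy : Subgroup.closure {x, y} = ⊤)
    {r : AbGroupRing G} (hr : aug p r = 0) :
    ∃ t α β, r = t * p + α * dif x + β * dif y := by
  obtain ⟨n, hn⟩ := exists_int_sub_mem r
  have h1 := aug_eq_zero_of_mem p hn
  rw [map_sub, hr, map_intCast, zero_sub, neg_eq_zero, ZMod.intCast_zmod_eq_zero_iff_dvd] at h1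
  obtain ⟨m, rfl⟩ := h1
  rw [augIdeal_eq_span hxy, Ideal.mem_span_pair] at hn
  obtain ⟨α, β, h⟩ := hn
  refine ⟨m, α, β, ?_⟩
  push_cast at h
  linear_combination -h

/-- The kernel of the augmentation mod p is generated by p, 1-x and 1-y, and each of these raises
the filtration. -/
theorem smul_mem_fil_of_aug_eq_zero {x y : G} (hxy : Subgroup.closure {x, y} = ⊤)
    (hp1 : ∀ z : DerivedModule G, (p : AbGroupRing G) • z ∈ fil G 1)
    {r : AbGroupRing G} (hr : aug p r = 0) {k : ℕ} {z : DerivedModule G} (hz : z ∈ fil G k) :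
    r • z ∈ fil G (k + 1) := by
  obtain ⟨t, α, β, rfl⟩ := exists_eq_of_aug_eq_zero hxy hr
  rw [add_smul, add_smul, mul_smul, mul_smul, mul_smul]
  exact add_mem (add_mem (Submodule.smul_mem _ _ (natCast_smul_mem_fil hp1 hz))
    (Submodule.smul_mem _ _ (dif_smul_mem_fil x hz)))
    (Submodule.smul_mem _ _ (dif_smul_mem_fil y hz))

/-- If t inverts r mod p, then 1 - tr acts nilpotently, and a finite geometric series inverts tr. -/
theorem actsLocally [Fact p.Prime] {x y : G} (hxy : Subgroup.closure {x, y} = ⊤)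
    (hp1 : ∀ z : DerivedModule G, (p : AbGroupRing G) • z ∈ fil G 1)
    {N : ℕ} (hN : fil G N = ⊥) : ActsLocally (aug (G := G) p) (DerivedModule G) := by
  intro r hr
  let t : AbGroupRing G := (((aug p r)⁻¹.val : ℕ) : AbGroupRing G)
  have ht : aug p (1 - t * r) = 0 := by
    simp [t, inv_mul_cancel₀ hr]
  have hpow : ∀ (k : ℕ) (z : DerivedModule G), (1 - t * r) ^ k • z ∈ fil G k := by
    intro k z
    induction k with
    | zero => rw [fil_zero]; exact mem_top
    | succ k ih =>
      rw [pow_succ', mul_smul]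
      exact smul_mem_fil_of_aug_eq_zero hxy hp1 ht ih
  refine ⟨(∑ i ∈ Finset.range N, (1 - t * r) ^ i) * t, fun z => ?_⟩
  have h1 := mul_neg_geom_sum (1 - t * r) N
  have h2 := hpow N z
  rw [hN, mem_bot] at h2
  rw [← mul_smul, show (∑ i ∈ Finset.range N, (1 - t * r) ^ i) * t * r = 1 - (1 - t * r) ^ N by
    linear_combination h1, sub_smul, one_smul, h2, sub_zero]

theorem fil_eq_top_of_fil_one (h : fil G 1 = ⊤) (k : ℕ) : fil G k = ⊤ := by
  induction k with
  | zero => exact fil_zero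
  | succ k ih => rw [fil_succ, ih, ← fil_zero, ← fil_succ, h, fil_zero]

theorem isUniserialGen [Fact p.Prime] {x y : G} (hxy : Subgroup.closure {x, y} = ⊤) {a : ℕ}
    {u : DerivedModule G} (hyu : dif y • u = 0)
    (hpu : (p : AbGroupRing G) • u ∈ span (AbGroupRing G) {dif x • u})
    (ha : dif x ^ a • u = 0) : IsUniserialGen (aug p) (dif x) a u := by
  refine ⟨fun r hr => ?_, ha⟩
  obtain ⟨t, α, β, rfl⟩ := exists_eq_of_aug_eq_zero hxy hr
  rw [add_smul, add_smul, mul_smul, mul_smul, mul_smul, hyu, smul_zero, add_zero]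
  exact add_mem (Submodule.smul_mem _ _ hpu) (Submodule.smul_mem _ _ (mem_span_singleton_self _))

/-- The number of submodules of the derived module when its radical is the sum of two cyclic
uniserial submodules. -/
theorem card_submodule [Fact p.Prime] [Finite G] {x y : G} (hxy : Subgroup.closure {x, y} = ⊤)
    (hexp : ∀ g : G, g ^ p ∈ commutator G) {N : ℕ} (hN : fil G N = ⊥) {a b : ℕ}
    {u v : DerivedModule G} (hyu : dif y • u = 0) (hxv : dif x • v = 0)
    (hpu : (p : AbGroupRing G) • u ∈ span (AbGroupRing G) {dif x • u})
    (hpv : (p : AbGroupRing G) • v ∈ span (AbGroupRing G) {dif y • v})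
    (ha : dif x ^ a • u = 0) (hb : dif y ^ b • v = 0) (hu : u ∈ fil G 1) (hv : v ∈ fil G 1)
    (huv : fil G 1 ≤ span (AbGroupRing G) {u} ⊔ span (AbGroupRing G) {v})
    (hcard : p ^ (a + b + 1) ≤ Nat.card (DerivedModule G)) :
    Nat.card (Submodule (AbGroupRing G) (DerivedModule G)) =
      1 + (a + 1) * (b + 1) + a * b * (p - 1) := by
  have hp1 := natCast_smul_mem_fil_one hexp hxy
  have hyx : Subgroup.closure {y, x} = ⊤ := by rwa [Set.pair_comm]
  have : Finite (DerivedModule G) := inferInstanceAs (Finite (commutator G))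
  have hpair : UniserialPair (aug p) (dif x) (dif y) a b u v :=
    ⟨isUniserialGen hxy hyu hpu ha, isUniserialGen hyx hxv hpv hb, hyu, hxv, aug_dif p x,
      aug_dif p y, actsLocally hxy hp1 hN⟩
  have hlay : layer (dif x) u 0 ⊔ layer (dif y) v 0 = fil G 1 := by
    simp only [layer, pow_zero, one_smul]
    exact le_antisymm (sup_le ((span_singleton_le_iff_mem _ _).2 hu)
      ((span_singleton_le_iff_mem _ _).2 hv)) huv
  refine hpair.card_submodule (span_comm hxy) ?_ ?_ hcard
  · intro r hr
    rw [hlay]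
    exact smul_mem_fil_of_aug_eq_zero hxy hp1 hr (by rw [fil_zero]; exact mem_top)
  · rw [hlay]
    -- Were γ_3 all of G', the filtration would never descend, yet it reaches zero on a nontrivial
    -- module.
    intro h1
    have h2 := fil_eq_top_of_fil_one h1 N
    rw [hN] at h2
    have h3 : Nat.card (DerivedModule G) ≤ 1 := by
      have : Subsingleton (DerivedModule G) := by
        rw [← Submodule.subsingleton_iff (AbGroupRing G)]
        exact subsingleton_of_bot_eq_top h2
      exact Finite.card_le_one_iff_subsingleton.2 this
    have h4 : 1 < p ^ (a + b + 1) := Nat.one_lt_pow (by omega) (Fact.out : p.Prime).one_lt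
    omega

end DerivedModule

end NormalLattice

/-! ### Subgroups of G/G' and comparability of normal subgroups with G'. -/

namespace NormalLattice

open Submodule

/-- Besides the two trivial submodules there are the |K|+1 points of the projective line. -/
theorem card_submodule_of_finrank_two (K V : Type*) [Field K] [Finite K] [AddCommGroup V]
    [Module K V] (h : Module.finrank K V = 2) :
    Nat.card (Submodule K V) = Nat.card K + 3 := by
  have : FiniteDimensional K V := Module.finite_of_finrank_pos (by omega)
  have : Finite V := Module.finite_of_finite K
  let F : Option (Option {H : Submodule K V // Module.finrank K H = 1}) → Submodule K V :=
    fun z => z.elim ⊥ (fun w => w.elim ⊤ Subtype.val)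
  have hbot : Module.finrank K (⊥ : Submodule K V) = 0 := finrank_bot K V
  have htop : Module.finrank K (⊤ : Submodule K V) = 2 := by rw [finrank_top, h]
  have hF : Function.Bijective F := by
    constructor
    · rintro (_ | _ | ⟨H, hH⟩) (_ | _ | ⟨H', hH'⟩) hz
      · rfl
      · have hz : (⊥ : Submodule K V) = ⊤ := hz
        rw [hz] at hbot; omega
      · have hz : (⊥ : Submodule K V) = H' := hz
        rw [hz] at hbot; omega
      · have hz : (⊤ : Submodule K V) = ⊥ := hz
        rw [hz] at htop; omega
      · rfl
      · have hz : (⊤ : Submodule K V) = H' := hz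
        rw [hz] at htop; omega
      · have hz : H = (⊥ : Submodule K V) := hz
        rw [← hz] at hbot; omega
      · have hz : H = (⊤ : Submodule K V) := hz
        rw [← hz] at htop; omega
      · obtain rfl : H = H' := hz
        rfl
    · intro H
      have h1 := Submodule.finrank_le H
      rw [h] at h1
      interval_cases h2 : Module.finrank K H
      · exact ⟨none, (Submodule.finrank_eq_zero.1 h2).symm⟩
      · exact ⟨some (some ⟨H, h2⟩), rfl⟩
      · exact ⟨some none, (Submodule.eq_top_of_finrank_eq (h2.trans h.symm)).symm⟩
  rw [← Nat.card_congr (Equiv.ofBijective F hF), Finite.card_option, Finite.card_option,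
    ← Nat.card_congr (Projectivization.equivSubmodule K V), Projectivization.card_of_finrank_two K V h]

theorem card_subgroup_of_mulEquiv {A : Type*} [Group A] {p : ℕ} [Fact p.Prime]
    (e : A ≃* Multiplicative (ZMod p × ZMod p)) : Nat.card (Subgroup A) = p + 3 := by
  have h2 : Module.finrank (ZMod p) (ZMod p × ZMod p) = 2 := by simp
  have h3 := card_submodule_of_finrank_two (ZMod p) (ZMod p × ZMod p) h2
  rw [Nat.card_zmod] at h3
  rw [← h3, ← Nat.card_congr (AddSubgroup.toZModSubmodule p (M := ZMod p × ZMod p)).toEquiv,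
    Nat.card_congr (AddSubgroup.toSubgroup (A := ZMod p × ZMod p)).toEquiv]
  exact Nat.card_congr e.mapSubgroup.toEquiv

section

variable {G : Type*} [Group G] {p : ℕ} [Fact p.Prime]

theorem pow_mem_commutator (e : Abelianization G ≃* Multiplicative (ZMod p × ZMod p)) (g : G) :
    g ^ p ∈ commutator G := by
  rw [← Abelianization.ker_of, MonoidHom.mem_ker, map_pow]
  apply e.injective
  rw [map_pow, map_one]
  apply Multiplicative.toAdd.injective
  rw [toAdd_pow, toAdd_one]
  ext <;> simp

theorem card_abelianization (e : Abelianization G ≃* Multiplicative (ZMod p × ZMod p)) :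
    Nat.card (Abelianization G) = p ^ 2 := by
  rw [Nat.card_congr e.toEquiv, Nat.card_congr Multiplicative.toAdd, Nat.card_prod, Nat.card_zmod,
    sq]

/-- In a nilpotent group, a subset generating modulo the commutator subgroup generates. -/
theorem eq_top_of_sup_commutator [Group.IsNilpotent G] {H : Subgroup G}
    (h : H ⊔ commutator G = ⊤) : H = ⊤ := by
  -- With Γ and N consecutive terms and HΓ = G, the subgroup HN is normal because [Γ, G] ≤ N.
  -- Commutators modulo HN reduce to commutators of elements of Γ, which lie in N; hence G' ≤ HN.
  have key : ∀ n, H ⊔ (⊤ : Subgroup G).lowerCentralSeries (n + 1) = ⊤ := by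
    intro n
    induction n with
    | zero => exact h
    | succ n ih =>
      set N := (⊤ : Subgroup G).lowerCentralSeries (n + 1 + 1) with hN
      set Γ := (⊤ : Subgroup G).lowerCentralSeries (n + 1) with hΓ
      have hcent : ∀ z ∈ Γ, ∀ g : G, ⁅z, g⁆ ∈ N := fun z hz g =>
        Subgroup.commutator_mem_commutator hz (Subgroup.mem_top g)
      have hnorm : (H ⊔ N).Normal := by
        constructor
        intro k hk g
        have hg : g ∈ H ⊔ Γ := ih ▸ Subgroup.mem_top g
        rw [← SetLike.mem_coe, Subgroup.mul_normal] at hg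
        obtain ⟨a, ha, z, hz, rfl⟩ := Set.mem_mul.1 hg
        have h1 : ⁅z, k⁆ ∈ H ⊔ N := Subgroup.mem_sup_right (hcent z hz k)
        have h2 : z * k * z⁻¹ ∈ H ⊔ N := by
          have := (H ⊔ N).mul_mem h1 hk
          rwa [commutatorElement_def, inv_mul_cancel_right] at this
        have h3 : a ∈ H ⊔ N := Subgroup.mem_sup_left ha
        have h4 := (H ⊔ N).mul_mem ((H ⊔ N).mul_mem h3 h2) ((H ⊔ N).inv_mem h3)
        convert h4 using 1
        group
      have hle : commutator G ≤ H ⊔ N := by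
        rw [commutator_def, Subgroup.commutator_le]
        intro g _ k _
        have hg : g ∈ H ⊔ Γ := ih ▸ Subgroup.mem_top g
        have hk : k ∈ H ⊔ Γ := ih ▸ Subgroup.mem_top k
        rw [← SetLike.mem_coe, Subgroup.mul_normal] at hg hk
        obtain ⟨a, ha, z, hz, rfl⟩ := Set.mem_mul.1 hg
        obtain ⟨b, hb, w, hw, rfl⟩ := Set.mem_mul.1 hk
        rw [← QuotientGroup.eq_one_iff]
        change QuotientGroup.mk' (H ⊔ N) ⁅a * z, b * w⁆ = 1
        have ha' : QuotientGroup.mk' (H ⊔ N) a = 1 :=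
          (QuotientGroup.eq_one_iff _).2 (Subgroup.mem_sup_left ha)
        have hb' : QuotientGroup.mk' (H ⊔ N) b = 1 :=
          (QuotientGroup.eq_one_iff _).2 (Subgroup.mem_sup_left hb)
        have hzw : QuotientGroup.mk' (H ⊔ N) ⁅z, w⁆ = 1 :=
          (QuotientGroup.eq_one_iff _).2 (Subgroup.mem_sup_right (hcent z hz w))
        rw [map_commutatorElement] at hzw ⊢
        rwa [map_mul, map_mul, ha', hb', one_mul, one_mul]
      exact top_le_iff.1 (h ▸ sup_le le_sup_left hle)
  obtain ⟨n, hn⟩ := Subgroup.nilpotent_iff_lowerCentralSeries.1 ‹Group.IsNilpotent G›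
  have h1 := key n
  have h2 : (⊤ : Subgroup G).lowerCentralSeries (n + 1) = ⊥ :=
    le_bot_iff.1 (hn ▸ Subgroup.lowerCentralSeries_antitone _ (Nat.le_succ n))
  rwa [h2, sup_bot_eq] at h1

theorem closure_eq_top_of_map [Group.IsNilpotent G] {s : Set G}
    (h : Subgroup.closure (Abelianization.of '' s) = ⊤) : Subgroup.closure s = ⊤ := by
  apply eq_top_of_sup_commutator
  rw [← Abelianization.ker_of, ← Subgroup.comap_map_eq, MonoidHom.map_closure, h,
    Subgroup.comap_top]

/-- Every element outside the commutator subgroup belongs to a generating pair. -/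
theorem exists_closure_pair_eq_top [Group.IsNilpotent G]
    (e : Abelianization G ≃* Multiplicative (ZMod p × ZMod p)) {y : G} (hy : y ∉ commutator G) :
    ∃ x : G, Subgroup.closure {x, y} = ⊤ := by
  have hcard := card_abelianization e
  have hp := (Fact.out : p.Prime)
  have : Finite (Abelianization G) := Nat.finite_of_card_ne_zero (by rw [hcard]; exact pow_ne_zero 2 hp.ne_zero)
  have hy1 : Abelianization.of y ≠ 1 := by
    intro h
    exact hy (by rwa [← Abelianization.ker_of, MonoidHom.mem_ker])
  have hord : orderOf (Abelianization.of y) = p := by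
    refine orderOf_eq_prime ?_ hy1
    have := pow_mem_commutator e y
    rwa [← Abelianization.ker_of, MonoidHom.mem_ker, map_pow] at this
  have hzc : Nat.card (Subgroup.zpowers (Abelianization.of y)) = p := by
    rw [Nat.card_zpowers, hord]
  have hne : Subgroup.zpowers (Abelianization.of y) ≠ ⊤ := by
    intro h
    rw [h, Subgroup.card_top, hcard] at hzc
    have := hp.one_lt
    nlinarith
  obtain ⟨x', hx'⟩ : ∃ x', x' ∉ Subgroup.zpowers (Abelianization.of y) := by
    by_contra! hall
    exact hne ((Subgroup.eq_top_iff' _).2 hall)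
  obtain ⟨x, rfl⟩ := QuotientGroup.mk_surjective x'
  refine ⟨x, closure_eq_top_of_map ?_⟩
  rw [Set.image_pair]
  set H := Subgroup.closure {Abelianization.of x, Abelianization.of y} with hH
  have hxH : Abelianization.of x ∈ H := Subgroup.subset_closure (by simp)
  have hyH : Abelianization.of y ∈ H := Subgroup.subset_closure (by simp)
  have hlt : Subgroup.zpowers (Abelianization.of y) < H := by
    refine lt_of_le_of_ne (Subgroup.zpowers_le.2 hyH) fun h => hx' ?_
    rw [h]
    exact hxH
  have hdvd := Subgroup.card_subgroup_dvd_card H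
  rw [hcard, Nat.dvd_prime_pow hp] at hdvd
  obtain ⟨k, hk, hkc⟩ := hdvd
  have hlt' : p < p ^ k := by
    rw [← hkc, ← hzc]
    exact Set.ncard_lt_ncard hlt (Set.toFinite _)
  have hk2 : k = 2 := by
    interval_cases k
    · have := hp.one_lt
      simp at hlt'; omega
    · simp at hlt'
    · rfl
  rw [hk2, ← hcard] at hkc
  exact Subgroup.eq_top_of_card_eq H hkc

theorem exists_closure_pair_eq_top' [Group.IsNilpotent G]
    (e : Abelianization G ≃* Multiplicative (ZMod p × ZMod p)) :
    ∃ x y : G, Subgroup.closure {x, y} = ⊤ := by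
  have hp := (Fact.out : p.Prime)
  obtain ⟨y, hy⟩ : ∃ y, y ∉ commutator G := by
    by_contra! hall
    have h1 := card_abelianization e
    have h2 : commutator G = ⊤ := (Subgroup.eq_top_iff' _).2 hall
    have h3 : Nat.card (Abelianization G) = 1 := by
      change (commutator G).index = 1
      rw [h2, Subgroup.index_top]
    rw [h3] at h1
    exact absurd h1.symm (Nat.one_lt_pow two_ne_zero hp.one_lt).ne'
  obtain ⟨x, hx⟩ := exists_closure_pair_eq_top e hy
  exact ⟨x, y, hx⟩

/-- A normal subgroup is comparable with the commutator subgroup. -/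
theorem commutator_le_of_not_le [Group.IsNilpotent G]
    (e : Abelianization G ≃* Multiplicative (ZMod p × ZMod p)) {N : Subgroup G} (hN : N.Normal)
    (h : ¬ N ≤ commutator G) : commutator G ≤ N := by
  obtain ⟨y, hyN, hy⟩ := SetLike.not_le_iff_exists.1 h
  obtain ⟨x, hxy⟩ := exists_closure_pair_eq_top e hy
  refine DerivedModule.commutator_le_of_mem hxy hN ?_
  -- [y,x] is y times a conjugate of y⁻¹, and both factors lie in `N`.
  rw [commutatorElement_def, mul_assoc, mul_assoc]
  refine N.mul_mem hyN ?_
  rw [← mul_assoc]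
  exact hN.conj_mem _ (N.inv_mem hyN) x

theorem card_normal [Finite G] [Group.IsNilpotent G] [IsMulCommutative (commutator G)]
    (e : Abelianization G ≃* Multiplicative (ZMod p × ZMod p)) :
    Nat.card {N : Subgroup G // N.Normal} =
      Nat.card (Submodule (AbGroupRing G) (DerivedModule G)) + (p + 2) := by
  -- G' itself is counted among the submodules, so the trivial subgroup of G/G' is excluded.
  let F : Submodule (AbGroupRing G) (DerivedModule G) ⊕
      {K : Subgroup (Abelianization G) // K ≠ ⊥} → {N : Subgroup G // N.Normal} := fun z =>
    z.elim (fun N => ⟨DerivedModule.toSubgroup N, DerivedModule.toSubgroup_normal N⟩)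
      (fun K => ⟨K.1.comap Abelianization.of, inferInstance⟩)
  have hsurj : Function.Surjective (Abelianization.of : G →* Abelianization G) :=
    QuotientGroup.mk_surjective
  have hmix : ∀ (N : Submodule (AbGroupRing G) (DerivedModule G))
      (K : Subgroup (Abelianization G)), K ≠ ⊥ →
      DerivedModule.toSubgroup N ≠ K.comap Abelianization.of := by
    intro N K hK h
    have h1 := DerivedModule.toSubgroup_le N
    rw [h, ← Abelianization.ker_of] at h1
    refine hK (Subgroup.comap_injective hsurj (le_antisymm ?_ ?_))
    · rwa [MonoidHom.comap_bot]
    · exact Subgroup.comap_mono bot_le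
  have hF : Function.Bijective F := by
    constructor
    · rintro (N | ⟨K, hK⟩) (N' | ⟨K', hK'⟩) hz
      · rw [DerivedModule.toSubgroup_injective (congrArg Subtype.val hz)]
      · exact absurd (congrArg Subtype.val hz) (hmix N K' hK')
      · exact absurd (congrArg Subtype.val hz).symm (hmix N' K hK)
      · obtain rfl : K = K' := Subgroup.comap_injective hsurj (congrArg Subtype.val hz)
        rfl
    · rintro ⟨N, hN⟩
      by_cases h : N ≤ commutator G
      · obtain ⟨N', hN'⟩ := DerivedModule.exists_toSubgroup_eq hN h
        exact ⟨Sum.inl N', Subtype.ext hN'⟩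
      · have h1 := commutator_le_of_not_le e hN h
        have h2 : (N.map Abelianization.of).comap Abelianization.of = N := by
          rw [Subgroup.comap_map_eq, Abelianization.ker_of, sup_eq_left.2 h1]
        refine ⟨Sum.inr ⟨N.map Abelianization.of, fun hb => h ?_⟩, Subtype.ext h2⟩
        rw [← h2, hb, MonoidHom.comap_bot, Abelianization.ker_of]
  have : Finite (DerivedModule G) := inferInstanceAs (Finite (commutator G))
  have : Finite (Abelianization G) := Finite.of_surjective _ hsurj
  rw [← Nat.card_congr (Equiv.ofBijective F hF), Nat.card_sum]
  have h1 := card_subgroup_of_mulEquiv e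
  classical
  have h2 := Nat.card_congr (Equiv.sumCompl (fun K : Subgroup (Abelianization G) => K = ⊥))
  rw [Nat.card_sum, Nat.card_unique, h1] at h2
  change 1 + Nat.card {K : Subgroup (Abelianization G) // K ≠ ⊥} = p + 3 at h2
  omega

end

end NormalLattice

/-! ### Lower central factors, the invariant e, and the defect. -/

namespace NormalLattice

open Submodule

section

variable {G : Type*} [Group G]

theorem gam_succ_le (j : ℕ) : gam G (j + 1) ≤ gam G j :=
  Subgroup.lowerCentralSeries_antitone _ (by omega)

theorem gam_antitone : Antitone (gam G) := antitone_nat_of_succ_le gam_succ_le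

theorem gam_succ {j : ℕ} (hj : 1 ≤ j) : gam G (j + 1) = ⁅gam G j, (⊤ : Subgroup G)⁆ := by
  obtain ⟨k, rfl⟩ := Nat.exists_eq_add_of_le' hj
  rfl

theorem gam_two : gam G 2 = commutator G := rfl

variable [Group.IsNilpotent G] {c : ℕ} (hc : Group.nilpotencyClass G = c)
include hc

theorem gam_class_succ : gam G (c + 1) = ⊥ := by
  rw [← hc]
  exact Subgroup.lowerCentralSeries_nilpotencyClass

theorem gam_ne_bot (hc1 : 1 ≤ c) : gam G c ≠ ⊥ := by
  intro h
  have := Subgroup.lowerCentralSeries_eq_bot_iff_nilpotencyClass_le.1 h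
  omega

theorem gam_succ_lt {j : ℕ} (hj : 1 ≤ j) (hjc : j ≤ c) : gam G (j + 1) < gam G j := by
  refine lt_of_le_of_ne (gam_succ_le j) fun h => ?_
  have key : ∀ k, gam G (j + k) = gam G j := by
    intro k
    induction k with
    | zero => rfl
    | succ k ih => rw [← add_assoc, gam_succ (by omega), ih, ← gam_succ hj, h]
  have h1 := key (c + 1 - j)
  rw [show j + (c + 1 - j) = c + 1 by omega, gam_class_succ hc] at h1
  exact gam_ne_bot hc (by omega) (le_bot_iff.1 (h1 ▸ gam_antitone hjc))

theorem isCyclic_gam_class_succ :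
    IsCyclic (gam G (c + 1) ⧸ (gam G (c + 2)).subgroupOf (gam G (c + 1))) := by
  have : Subsingleton (gam G (c + 1)) := by
    rw [gam_class_succ hc]
    infer_instance
  have := (QuotientGroup.mk_surjective
    (s := (gam G (c + 2)).subgroupOf (gam G (c + 1)))).subsingleton
  infer_instance

theorem invE_le (hc2 : 2 ≤ c) : invE G ≤ c :=
  Nat.sInf_le ⟨hc2, isCyclic_gam_class_succ hc⟩

theorem two_le_invE (hc2 : 2 ≤ c) : 2 ≤ invE G := by
  have hne : {j : ℕ | 2 ≤ j ∧
      IsCyclic (gam G (j + 1) ⧸ (gam G (j + 2)).subgroupOf (gam G (j + 1)))}.Nonempty :=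
    ⟨c, hc2, isCyclic_gam_class_succ hc⟩
  exact (Nat.sInf_mem hne).1

omit hc [Group.IsNilpotent G] in
theorem not_isCyclic_of_lt_invE {j : ℕ} (hj2 : 2 ≤ j) (hj : j < invE G) :
    ¬ IsCyclic (gam G (j + 1) ⧸ (gam G (j + 2)).subgroupOf (gam G (j + 1))) := by
  intro h
  exact Nat.notMem_of_lt_sInf hj ⟨hj2, h⟩

/-- The defect of commutativity being zero provides an element outside the commutator subgroup
that centralizes `γ_e`. -/
theorem exists_centralizing (hc2 : 2 ≤ c) (hk : HasDefect G 0) :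
    ∃ g : G, g ∉ commutator G ∧ ∀ a ∈ gam G (invE G), ⁅a, g⁆ = 1 := by
  -- χ_c = G because γ_c is central, so the infimum defining s is attained and is not the default
  -- value.
  have hne : {j : ℕ | 2 ≤ j ∧ gam G 2 < chi G j}.Nonempty := by
    refine ⟨c, hc2, ?_⟩
    have h1 : chi G c = ⊤ := by
      refine top_le_iff.1 (le_sSup ⟨le_top, ?_⟩)
      rw [Subgroup.commutator_comm, ← gam_succ (by omega), gam_class_succ hc]
      exact bot_le
    rw [h1, lt_top_iff_ne_top]
    intro h2
    have h3 := gam_succ_lt hc (j := 1) le_rfl (by omega)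
    rw [h2] at h3
    exact not_top_lt h3
  have h1 : gam G 2 < chi G (invS G) := (Nat.sInf_mem hne).2
  obtain ⟨g, hg, hg2⟩ := SetLike.exists_of_lt h1
  refine ⟨g, hg2, fun a ha => ?_⟩
  have h2 := hk.2
  rw [hc, Nat.sub_zero, gam_class_succ hc] at h2
  have h3 := Subgroup.commutator_mem_commutator hg ha
  rw [h2, Subgroup.mem_bot] at h3
  rw [← commutatorElement_inv, h3, inv_one]

omit hc [Group.IsNilpotent G] in
theorem card_gam_eq (j : ℕ) : Nat.card (gam G j) =
    Nat.card (gam G j ⧸ (gam G (j + 1)).subgroupOf (gam G j)) * Nat.card (gam G (j + 1)) := by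
  rw [Subgroup.card_eq_card_quotient_mul_card_subgroup ((gam G (j + 1)).subgroupOf (gam G j)),
    Nat.card_congr (Subgroup.subgroupOfEquivOfLe (gam_succ_le j)).toEquiv]

variable {p n : ℕ} [Fact p.Prime] (hG : Nat.card G = p ^ n)
include hG

omit hc [Group.IsNilpotent G] in
theorem exists_card_quotient_eq (j : ℕ) :
    ∃ k, Nat.card (gam G j ⧸ (gam G (j + 1)).subgroupOf (gam G j)) = p ^ k := by
  have h1 : Nat.card (gam G j ⧸ (gam G (j + 1)).subgroupOf (gam G j)) ∣ p ^ n := by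
    rw [← hG]
    exact (Dvd.intro _ (card_gam_eq j).symm).trans (Subgroup.card_subgroup_dvd_card _)
  obtain ⟨k, -, hk⟩ := (Nat.dvd_prime_pow Fact.out).1 h1
  exact ⟨k, hk⟩

theorem mul_card_gam_le {j : ℕ} (hj : 1 ≤ j) (hjc : j ≤ c) :
    p * Nat.card (gam G (j + 1)) ≤ Nat.card (gam G j) := by
  have hp := (Fact.out : p.Prime)
  obtain ⟨k, hk⟩ := exists_card_quotient_eq hG j
  have : Finite G := Nat.finite_of_card_ne_zero (by rw [hG]; exact pow_ne_zero n hp.ne_zero)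
  rw [card_gam_eq j]
  refine Nat.mul_le_mul_right _ ?_
  rw [hk]
  refine Nat.le_self_pow ?_ p
  rintro rfl
  have h1 := Set.ncard_lt_ncard (SetLike.coe_ssubset_coe.2 (gam_succ_lt hc hj hjc)) (Set.toFinite _)
  have h2 := card_gam_eq (G := G) j
  rw [hk, pow_zero, one_mul] at h2
  exact absurd h2 h1.ne'

omit hc [Group.IsNilpotent G] in
-- A noncyclic group of p-power order has order at least p².
theorem sq_mul_card_gam_le {j : ℕ} (hj : 2 ≤ j) (hje : j < invE G) :
    p ^ 2 * Nat.card (gam G (j + 2)) ≤ Nat.card (gam G (j + 1)) := by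
  have hp := (Fact.out : p.Prime)
  obtain ⟨k, hk⟩ := exists_card_quotient_eq hG (j + 1)
  rw [card_gam_eq (j + 1)]
  refine Nat.mul_le_mul_right _ ?_
  have hnc := not_isCyclic_of_lt_invE hj hje
  rw [show j + 1 + 1 = j + 2 from rfl] at hk ⊢
  rw [hk]
  refine Nat.pow_le_pow_right hp.pos ?_
  by_contra! hk2
  interval_cases k
  · refine hnc ?_
    have := (Nat.card_eq_one_iff_unique.1 hk).1
    infer_instance
  · exact hnc (isCyclic_of_prime_card (p := p) (by rw [hk, pow_one]))

/-- The c-1 factors γ_j/γ_{j+1}, 2 ≤ j ≤ c, have order at least p; the e-2 of them with 3 ≤ j ≤ e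
are noncyclic and contribute another p each. -/
theorem pow_le_card_gam_two (hc2 : 2 ≤ c) :
    p ^ (c - 1 + (invE G - 2)) ≤ Nat.card (gam G 2) := by
  have hp := (Fact.out : p.Prime)
  have : Finite G := Nat.finite_of_card_ne_zero (by rw [hG]; exact pow_ne_zero n hp.ne_zero)
  have he := invE_le hc hc2
  have he2 := two_le_invE hc hc2
  have tail : ∀ k, k ≤ c → p ^ k ≤ Nat.card (gam G (c + 1 - k)) := by
    intro k
    induction k with
    | zero => intro _; simpa using Nat.one_le_iff_ne_zero.2 Nat.card_pos.ne'
    | succ k ih =>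
      intro hk
      have h1 := mul_card_gam_le hc hG (j := c + 1 - (k + 1)) (by omega) (by omega)
      rw [show c + 1 - (k + 1) + 1 = c + 1 - k by omega] at h1
      rw [pow_succ']
      exact (Nat.mul_le_mul_left _ (ih (by omega))).trans h1
  have head : ∀ k, k ≤ invE G - 2 →
      p ^ (c - invE G + 2 * k) ≤ Nat.card (gam G (invE G + 1 - k)) := by
    intro k
    induction k with
    | zero =>
      intro _
      have := tail (c - invE G) (by omega)
      rwa [show c + 1 - (c - invE G) = invE G + 1 - 0 by omega] at this
    | succ k ih =>
      intro hk
      have h1 := sq_mul_card_gam_le hG (j := invE G + 1 - (k + 1) - 1) (by omega) (by omega)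
      rw [show invE G + 1 - (k + 1) - 1 + 2 = invE G + 1 - k by omega,
        show invE G + 1 - (k + 1) - 1 + 1 = invE G + 1 - (k + 1) by omega] at h1
      rw [show c - invE G + 2 * (k + 1) = 2 + (c - invE G + 2 * k) by ring, pow_add]
      exact (Nat.mul_le_mul_left _ (ih (by omega))).trans h1
  have h1 := head (invE G - 2) le_rfl
  rw [show invE G + 1 - (invE G - 2) = 2 + 1 by omega] at h1
  have h2 := mul_card_gam_le hc hG (j := 2) (by omega) (by omega)
  rw [show c - 1 + (invE G - 2) = (c - invE G + 2 * (invE G - 2)) + 1 by omega, pow_succ']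
  exact (Nat.mul_le_mul_left _ h1).trans h2

end

end NormalLattice

/-! ### Cubes of generators in metabelian 3-groups. -/

namespace NormalLattice

open Submodule

/-- Cramer's rule mod 3: two relations with invertible minor express A and B through C modulo S. -/
theorem exists_int_sub_smul_mem {Q : Type*} [AddCommGroup Q] {P S : AddSubgroup Q} {A B C : Q}
    (hA : (3 : ℤ) • A ∈ S) (hB : (3 : ℤ) • B ∈ S)
    (hspan : ∀ t ∈ P, ∃ n₁ n₂ n₃ : ℤ, t - (n₁ • A + n₂ • B + n₃ • C) ∈ S)
    {a₁ a₂ a₃ b₁ b₂ b₃ : ℤ} (ha : a₁ • A + a₂ • B + a₃ • C ∈ S)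
    (hb : b₁ • A + b₂ • B + b₃ • C ∈ S) (hdet : ¬ (3 : ℤ) ∣ a₁ * b₂ - a₂ * b₁) :
    ∀ t ∈ P, ∃ n : ℤ, t - n • C ∈ S := by
  have hcop : IsCoprime (3 : ℤ) (a₁ * b₂ - a₂ * b₁) :=
    (Int.prime_three.coprime_iff_not_dvd).2 hdet
  obtain ⟨k, ε, hε⟩ := hcop
  have h1 : A - (-(ε * (a₃ * b₂ - a₂ * b₃))) • C ∈ S := by
    have : A - (-(ε * (a₃ * b₂ - a₂ * b₃))) • C = k • (3 : ℤ) • A + (ε * b₂) • (a₁ • A + a₂ • B + a₃ • C)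
        - (ε * a₂) • (b₁ • A + b₂ • B + b₃ • C) := by
      have : A = (k * 3 + ε * (a₁ * b₂ - a₂ * b₁)) • A := by rw [hε, one_smul]
      nth_rewrite 1 [this]
      module
    rw [this]
    exact sub_mem (add_mem (zsmul_mem hA k) (zsmul_mem ha _)) (zsmul_mem hb _)
  have h2 : B - (-(ε * (a₁ * b₃ - a₃ * b₁))) • C ∈ S := by
    have : B - (-(ε * (a₁ * b₃ - a₃ * b₁))) • C = k • (3 : ℤ) • B + (ε * a₁) • (b₁ • A + b₂ • B + b₃ • C)
        - (ε * b₁) • (a₁ • A + a₂ • B + a₃ • C) := by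
      have : B = (k * 3 + ε * (a₁ * b₂ - a₂ * b₁)) • B := by rw [hε, one_smul]
      nth_rewrite 1 [this]
      module
    rw [this]
    exact sub_mem (add_mem (zsmul_mem hB k) (zsmul_mem hb _)) (zsmul_mem ha _)
  intro t ht
  obtain ⟨n₁, n₂, n₃, hn⟩ := hspan t ht
  refine ⟨n₁ * (-(ε * (a₃ * b₂ - a₂ * b₃))) + n₂ * (-(ε * (a₁ * b₃ - a₃ * b₁))) + n₃, ?_⟩
  have := add_mem (add_mem hn (zsmul_mem h1 n₁)) (zsmul_mem h2 n₂)
  convert this using 1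
  module

/-- The a's and b's are the coordinates of x³ and y³ in γ_3/γ_4. The hypotheses are the 2×2 minors
of three relations in γ_4/γ_5; the conclusion says that two of x³, y³, (xy)³, (xy²)³ are
independent. -/
theorem exists_det_ne_zero : ∀ a₁ a₂ b₁ b₂ : ZMod 3,
    a₁ * b₁ - a₂ * 0 = 0 → a₁ * b₂ - 0 * 0 = 0 → a₂ * b₂ - 0 * b₁ = 0 →
    a₁ * (a₁ + b₂) - a₂ * (1 + b₁) = 0 → a₁ * (a₂ - 1) - 0 * (1 + b₁) = 0 →
    a₂ * (a₂ - 1) - 0 * (a₁ + b₂) = 0 →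
    0 * (a₁ + b₂) - b₁ * (1 + b₁) = 0 → 0 * (a₂ - 1) - b₂ * (1 + b₁) = 0 →
    b₁ * (a₂ - 1) - b₂ * (a₁ + b₂) = 0 →
    a₁ * b₂ - a₂ * b₁ ≠ 0 ∨
    a₁ * (a₂ + b₂ - 1) - a₂ * (a₁ + b₁ + 1) ≠ 0 ∨
    a₁ * (a₂ + b₂ - 1 + b₂) - a₂ * (a₁ + b₁ + 1 + b₁ + 1) ≠ 0 ∨
    b₁ * (a₂ + b₂ - 1) - b₂ * (a₁ + b₁ + 1) ≠ 0 ∨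
    b₁ * (a₂ + b₂ - 1 + b₂) - b₂ * (a₁ + b₁ + 1 + b₁ + 1) ≠ 0 ∨
    (a₁ + b₁ + 1) * (a₂ + b₂ - 1 + b₂) - (a₂ + b₂ - 1) * (a₁ + b₁ + 1 + b₁ + 1) ≠ 0 := by
  decide

namespace DerivedModule

variable {G : Type*} [Group G] [IsMulCommutative (commutator G)]

theorem mem_fil_zero (z : DerivedModule G) : z ∈ fil G 0 := by
  rw [fil_zero]
  exact mem_top

theorem exists_eq_of_mem_fil_succ {x y : G} (hxy : Subgroup.closure {x, y} = ⊤) {k : ℕ}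
    {z : DerivedModule G} (hz : z ∈ fil G (k + 1)) :
    ∃ z₁ ∈ fil G k, ∃ z₂ ∈ fil G k, z = dif x • z₁ + dif y • z₂ := by
  rw [fil_succ] at hz
  induction hz using smul_induction_on' with
  | smul r hr w hw =>
    rw [augIdeal_eq_span hxy, Ideal.mem_span_pair] at hr
    obtain ⟨α, β, rfl⟩ := hr
    refine ⟨α • w, Submodule.smul_mem _ _ hw, β • w, Submodule.smul_mem _ _ hw, ?_⟩
    module
  | add w _ w' _ h1 h2 =>
    obtain ⟨z₁, hz₁, z₂, hz₂, rfl⟩ := h1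
    obtain ⟨z₁', hz₁', z₂', hz₂', rfl⟩ := h2
    refine ⟨z₁ + z₁', add_mem hz₁ hz₁', z₂ + z₂', add_mem hz₂ hz₂', ?_⟩
    module

theorem fil_one_le {x y : G} (hxy : Subgroup.closure {x, y} = ⊤) :
    fil G 1 ≤ span (AbGroupRing G) {dif x • comm y x} ⊔
      span (AbGroupRing G) {dif y • comm y x} := by
  intro z hz
  obtain ⟨z₁, -, z₂, -, rfl⟩ := exists_eq_of_mem_fil_succ hxy hz
  obtain ⟨r₁, rfl⟩ := mem_span_singleton.1 (span_comm hxy ▸ mem_top : z₁ ∈ span _ {comm y x})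
  obtain ⟨r₂, rfl⟩ := mem_span_singleton.1 (span_comm hxy ▸ mem_top : z₂ ∈ span _ {comm y x})
  rw [smul_comm _ r₁, smul_comm _ r₂]
  exact add_mem (mem_sup_left (Submodule.smul_mem _ _ (mem_span_singleton_self _)))
    (mem_sup_right (Submodule.smul_mem _ _ (mem_span_singleton_self _)))

theorem exists_sub_mem_fil_one {x y : G} (hxy : Subgroup.closure {x, y} = ⊤)
    (z : DerivedModule G) : ∃ n : ℤ, z - n • comm y x ∈ fil G 1 := by
  obtain ⟨r, rfl⟩ := mem_span_singleton.1 (span_comm hxy ▸ mem_top : z ∈ span _ {comm y x})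
  obtain ⟨n, hn⟩ := exists_int_sub_mem r
  refine ⟨n, ?_⟩
  rw [← Int.cast_smul_eq_zsmul (AbGroupRing G), ← sub_smul, fil_succ]
  exact smul_mem_smul hn (mem_fil_zero _)

theorem exists_sub_mem_fil_two {x y : G} (hxy : Subgroup.closure {x, y} = ⊤)
    {z : DerivedModule G} (hz : z ∈ fil G 1) :
    ∃ m n : ℤ, z - (m • dif x • comm y x + n • dif y • comm y x) ∈ fil G 2 := by
  obtain ⟨z₁, -, z₂, -, rfl⟩ := exists_eq_of_mem_fil_succ hxy hz
  obtain ⟨m, hm⟩ := exists_sub_mem_fil_one hxy z₁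
  obtain ⟨n, hn⟩ := exists_sub_mem_fil_one hxy z₂
  refine ⟨m, n, ?_⟩
  have := add_mem (dif_smul_mem_fil x hm) (dif_smul_mem_fil y hn)
  convert this using 1
  rw [smul_sub, smul_sub, smul_comm m, smul_comm n]
  abel

theorem exists_sub_mem_fil_three {x y : G} (hxy : Subgroup.closure {x, y} = ⊤)
    {z : DerivedModule G} (hz : z ∈ fil G 2) :
    ∃ n₁ n₂ n₃ : ℤ, z - (n₁ • dif x • dif x • comm y x + n₂ • dif x • dif y • comm y x +
      n₃ • dif y • dif y • comm y x) ∈ fil G 3 := by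
  obtain ⟨z₁, hz₁, z₂, hz₂, rfl⟩ := exists_eq_of_mem_fil_succ hxy hz
  obtain ⟨m, n, hm⟩ := exists_sub_mem_fil_two hxy hz₁
  obtain ⟨m', n', hn⟩ := exists_sub_mem_fil_two hxy hz₂
  refine ⟨m, n + m', n', ?_⟩
  have := add_mem (dif_smul_mem_fil x hm) (dif_smul_mem_fil y hn)
  convert this using 1
  simp only [smul_sub, smul_add, add_smul, smul_comm (dif x) m, smul_comm (dif x) n,
    smul_comm (dif y) m', smul_comm (dif y) n', smul_comm (dif y) (dif x)]
  abel

/-- Nakayama's lemma for the nilpotent action of the augmentation ideal. -/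
theorem le_of_le_sup_fil_two {W : Submodule (AbGroupRing G) (DerivedModule G)} {N : ℕ}
    (hN : fil G N = ⊥) (hW : fil G 1 ≤ W ⊔ fil G 2) : fil G 1 ≤ W := by
  have key : ∀ k, fil G 1 ≤ W ⊔ fil G (k + 1) := by
    intro k
    induction k with
    | zero => exact le_sup_right
    | succ k ih =>
      refine hW.trans (sup_le le_sup_left ?_)
      rw [fil_succ 1, fil_succ (k + 1)]
      refine (smul_mono_right _ ih).trans ?_
      rw [smul_sup]
      exact sup_le_sup smul_le_right le_rfl
  have h1 := key N
  have h2 : fil G (N + 1) = ⊥ := le_bot_iff.1 ((fil_antitone (Nat.le_succ N)).trans_eq hN)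
  rwa [h2, sup_bot_eq] at h1

section

variable {p : ℕ} (hexp : ∀ g : G, g ^ p ∈ commutator G)

/-- Write y^p = r s and multiply the trace relation for s by r: the term with Y drops out since Y
kills y^p. -/
theorem natCast_smul_pw_mem {x y : G} (hxy : Subgroup.closure {x, y} = ⊤) :
    (p : AbGroupRing G) • pw hexp y ∈ span (AbGroupRing G) {dif x • pw hexp y} := by
  obtain ⟨r, hr⟩ := mem_span_singleton.1
    (span_comm hxy ▸ mem_top : pw hexp y ∈ span _ {comm y x})
  obtain ⟨q, hq⟩ := geom_sum_eq (grp y) p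
  have h1 := geom_sum_smul_comm hexp y x
  have h2 := dif_smul_pw_self hexp y
  refine mem_span_singleton.2 ⟨r, ?_⟩
  rw [← h1, hq, smul_comm, hr, sub_smul, mul_comm, mul_smul]
  change _ - q • dif y • pw hexp y = _
  rw [h2, smul_zero, sub_zero]

/-- The `p`-th power of a generator lies in `γ_3` unless `γ_3` is generated by one chain. -/
theorem pw_mem_fil_one [Fact p.Prime] {x y : G} (hxy : Subgroup.closure {x, y} = ⊤)
    {N : ℕ} (hN : fil G N = ⊥)
    (hnc : ¬ ∃ z ∈ fil G 2, ∀ t ∈ fil G 2, ∃ n : ℤ, t - n • z ∈ fil G 3) :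
    pw hexp x ∈ fil G 1 := by
  by_contra hmem
  have hp1 := natCast_smul_mem_fil_one hexp hxy
  obtain ⟨r, hr⟩ := mem_span_singleton.1
    (span_comm hxy ▸ mem_top : pw hexp x ∈ span _ {comm y x})
  have hr0 : aug p r ≠ 0 := fun h => hmem (by
    rw [← hr]
    exact smul_mem_fil_of_aug_eq_zero hxy hp1 h (mem_fil_zero _))
  obtain ⟨r', hr'⟩ := actsLocally hxy hp1 hN r hr0
  -- A p-th power outside γ_3 generates the module. As X kills x^p it kills s, so only YYs survives
  -- in γ_4/γ_5.
  have hXs : dif x • comm y x = 0 := by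
    rw [← hr' (comm y x), hr, smul_comm, dif_smul_pw_self, smul_zero]
  refine hnc ⟨dif y • dif y • comm y x,
    dif_smul_mem_fil y (dif_smul_mem_fil y (mem_fil_zero _)), fun t ht => ?_⟩
  obtain ⟨n₁, n₂, n₃, hn⟩ := exists_sub_mem_fil_three hxy ht
  refine ⟨n₃, ?_⟩
  rwa [smul_comm (dif x) (dif y), hXs, smul_zero, smul_zero, smul_zero, smul_zero, zero_add,
    zero_add] at hn

end

section Three

variable (hexp : ∀ g : G, g ^ 3 ∈ commutator G)

theorem pw_mul (g h : G) : pw hexp (g * h) =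
    comm g h + grp h • comm (g ^ 2) h + grp (h ^ 2) • comm (g ^ 3) h + pw hexp h + pw hexp g := by
  apply val_injective
  simp only [pw, val_mk, val_add, val_grp_smul, val_comm, commutatorElement_def]
  rw [show (g * h) ^ 3 = g * h * (g * h) * (g * h) by rw [pow_succ, sq]]
  group

/-- Modulo γ_4 cubing fails to be additive only by a commutator term, which is what separates the
cubes of xy and xy² from combinations of x³ and y³. -/
theorem pw_mul_sub_mem (h3 : ∀ z : DerivedModule G, (3 : AbGroupRing G) • z ∈ fil G 2) (g h : G) :
    pw hexp (g * h) - (pw hexp g + pw hexp h + (dif g - dif h) • comm h g) ∈ fil G 2 := by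
  have h0 := mem_fil_zero (comm h g)
  have hgg := dif_smul_mem_fil g (dif_smul_mem_fil g h0)
  have hgh := dif_smul_mem_fil g (dif_smul_mem_fil h h0)
  have hhh := dif_smul_mem_fil h (dif_smul_mem_fil h h0)
  have key : pw hexp (g * h) - (pw hexp g + pw hexp h + (dif g - dif h) • comm h g) =
      (-2 + dif g + 3 * dif h) • (3 : AbGroupRing G) • comm h g -
      ((1 - 2 * dif h) • dif g • dif g • comm h g + (7 : AbGroupRing G) • dif g • dif h • comm h g +
        (3 - 3 * dif g + dif g ^ 2) • dif h • dif h • comm h g) := by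
    rw [pw_mul, comm_pow_left, comm_pow_left, comm_swap g h]
    simp only [Finset.sum_range_succ, Finset.sum_range_zero, pow_zero, pow_one, zero_add, grp_pow,
      dif]
    module
  rw [key]
  exact sub_mem (Submodule.smul_mem _ _ (h3 _)) (add_mem (add_mem (Submodule.smul_mem _ _ hgg)
    (Submodule.smul_mem _ _ hgh)) (Submodule.smul_mem _ _ hhh))

theorem trace_smul_comm (g h : G) :
    (3 : AbGroupRing G) • comm g h - (3 : AbGroupRing G) • dif g • comm g h +
      dif g • dif g • comm g h = dif h • pw hexp g := by
  rw [← geom_sum_smul_comm hexp g h]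
  simp only [Finset.sum_range_succ, Finset.sum_range_zero, pow_zero, pow_one, zero_add, dif]
  module

/-- Solving the trace relation for 3s gives X y³ + 3Ys - YYs, and every term lies in γ_4. -/
theorem three_smul_mem_fil_two {x y : G} (hxy : Subgroup.closure {x, y} = ⊤)
    (hy : pw hexp y ∈ fil G 1) (z : DerivedModule G) : (3 : AbGroupRing G) • z ∈ fil G 2 := by
  have hp1 : ∀ z : DerivedModule G, (3 : AbGroupRing G) • z ∈ fil G 1 := fun z => by
    exact_mod_cast natCast_smul_mem_fil_one hexp hxy z
  obtain ⟨r, rfl⟩ := mem_span_singleton.1 (span_comm hxy ▸ mem_top : z ∈ span _ {comm y x})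
  rw [smul_comm]
  refine Submodule.smul_mem _ _ ?_
  have h1 := trace_smul_comm hexp y x
  have h2 : (3 : AbGroupRing G) • comm y x = dif x • pw hexp y +
      dif y • (3 : AbGroupRing G) • comm y x - dif y • dif y • comm y x := by
    rw [← h1]
    module
  rw [h2]
  exact sub_mem (add_mem (dif_smul_mem_fil x hy) (dif_smul_mem_fil y (hp1 _)))
    (dif_smul_mem_fil y (dif_smul_mem_fil y (mem_fil_zero _)))

theorem three_smul_mem_fil_three {x y : G} (hxy : Subgroup.closure {x, y} = ⊤)
    (h3 : ∀ z : DerivedModule G, (3 : AbGroupRing G) • z ∈ fil G 2) {z : DerivedModule G}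
    (hz : z ∈ fil G 1) : (3 : AbGroupRing G) • z ∈ fil G 3 := by
  obtain ⟨z₁, -, z₂, -, rfl⟩ := exists_eq_of_mem_fil_succ hxy hz
  rw [smul_add, smul_comm, smul_comm _ (dif y)]
  exact add_mem (dif_smul_mem_fil x (h3 _)) (dif_smul_mem_fil y (h3 _))

theorem fil_one_le_of_det {x y : G} (hxy : Subgroup.closure {x, y} = ⊤)
    (h3 : ∀ z : DerivedModule G, (3 : AbGroupRing G) • z ∈ fil G 2) {N : ℕ} (hN : fil G N = ⊥)
    {u v : DerivedModule G} {u₁ u₂ v₁ v₂ : ℤ}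
    (hu : u - (u₁ • dif x • comm y x + u₂ • dif y • comm y x) ∈ fil G 2)
    (hv : v - (v₁ • dif x • comm y x + v₂ • dif y • comm y x) ∈ fil G 2)
    (hdet : ((u₁ * v₂ - u₂ * v₁ : ℤ) : ZMod 3) ≠ 0) :
    fil G 1 ≤ span (AbGroupRing G) {u} ⊔ span (AbGroupRing G) {v} := by
  have hdet' : ¬ (3 : ℤ) ∣ u₁ * v₂ - u₂ * v₁ := by
    rwa [ne_eq, ZMod.intCast_zmod_eq_zero_iff_dvd] at hdet
  refine le_of_le_sup_fil_two hN ?_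
  set W := span (AbGroupRing G) {u} ⊔ span (AbGroupRing G) {v} with hW
  have huW : u ∈ W ⊔ fil G 2 := mem_sup_left (mem_sup_left (mem_span_singleton_self u))
  have hvW : v ∈ W ⊔ fil G 2 := mem_sup_left (mem_sup_right (mem_span_singleton_self v))
  set S : AddSubgroup (DerivedModule G) := (W ⊔ fil G 2).toAddSubgroup with hS
  have h3' : ∀ z : DerivedModule G, (3 : ℤ) • z ∈ S := fun z => by
    have := h3 z
    rw [← Int.cast_smul_eq_zsmul (AbGroupRing G)]
    exact mem_sup_right (by exact_mod_cast this)
  have hu' : u₁ • dif x • comm y x + u₂ • dif y • comm y x + (0 : ℤ) • (0 : DerivedModule G) ∈ S := by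
    have := sub_mem huW (mem_sup_right (S := W) hu)
    rw [sub_sub_cancel] at this
    rwa [smul_zero, add_zero]
  have hv' : v₁ • dif x • comm y x + v₂ • dif y • comm y x + (0 : ℤ) • (0 : DerivedModule G) ∈ S := by
    have := sub_mem hvW (mem_sup_right (S := W) hv)
    rw [sub_sub_cancel] at this
    rwa [smul_zero, add_zero]
  intro z hz
  obtain ⟨n, hn⟩ := exists_int_sub_smul_mem (P := (fil G 1).toAddSubgroup) (S := S) (C := 0)
    (h3' _) (h3' _) (fun t ht => by
      obtain ⟨m, n, h⟩ := exists_sub_mem_fil_two hxy ht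
      exact ⟨m, n, 0, by rw [smul_zero, add_zero]; exact mem_sup_right h⟩) hu' hv' hdet' z hz
  rw [smul_zero, sub_zero] at hn
  exact hn

/-- In a metabelian `3`-group with non-cyclic `γ_4/γ_5`, there are generators whose cubes
generate `γ_3` as a normal subgroup. -/
theorem exists_generators_cubes [Group.IsNilpotent G] {x y : G}
    (hxy : Subgroup.closure {x, y} = ⊤) {N : ℕ} (hN : fil G N = ⊥)
    (hnc : ¬ ∃ z ∈ fil G 2, ∀ t ∈ fil G 2, ∃ n : ℤ, t - n • z ∈ fil G 3) :
    ∃ g h : G, Subgroup.closure {g, h} = ⊤ ∧ pw hexp g ∈ fil G 1 ∧ pw hexp h ∈ fil G 1 ∧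
      fil G 1 ≤ span (AbGroupRing G) {pw hexp g} ⊔ span (AbGroupRing G) {pw hexp h} := by
  have hyx : Subgroup.closure {y, x} = ⊤ := by rwa [Set.pair_comm]
  have hx1 := pw_mem_fil_one hexp hxy hN hnc
  have hy1 := pw_mem_fil_one hexp hyx hN hnc
  have h3 := three_smul_mem_fil_two hexp hxy hy1
  set s := comm y x with hs
  obtain ⟨a₁, a₂, ha⟩ := exists_sub_mem_fil_two hxy hx1
  obtain ⟨b₁, b₂, hb⟩ := exists_sub_mem_fil_two hxy hy1
  rw [← hs] at ha hb
  have hXs : dif x • s ∈ fil G 1 := dif_smul_mem_fil x (mem_fil_zero _)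
  have hYs : dif y • s ∈ fil G 1 := dif_smul_mem_fil y (mem_fil_zero _)
  -- `r1` and `r2` are X x³ = 0 and Y y³ = 0, read modulo γ_5.
  have r1 : a₁ • dif x • dif x • s + a₂ • dif x • dif y • s + (0 : ℤ) • dif y • dif y • s ∈
      fil G 3 := by
    have := neg_mem (dif_smul_mem_fil x ha)
    rw [smul_sub, dif_smul_pw_self] at this
    convert this using 1
    rw [smul_add, smul_comm (dif x) a₁, smul_comm (dif x) a₂]
    module
  have r2 : (0 : ℤ) • dif x • dif x • s + b₁ • dif x • dif y • s + b₂ • dif y • dif y • s ∈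
      fil G 3 := by
    have := neg_mem (dif_smul_mem_fil y hb)
    rw [smul_sub, dif_smul_pw_self] at this
    convert this using 1
    rw [smul_add, smul_comm (dif y) b₁, smul_comm (dif y) b₂, smul_comm (dif y) (dif x)]
    module
  -- Adding the trace relations for (y,x) and (x,y) cancels 3s; the terms 3Xs and 3Ys lie in γ_5.
  have r3 : (1 + b₁) • dif x • dif x • s + (a₁ + b₂) • dif x • dif y • s +
      (a₂ - 1) • dif y • dif y • s ∈ fil G 3 := by
    have t1 := trace_smul_comm hexp y x
    have t2 := trace_smul_comm hexp x y
    rw [comm_swap x y] at t2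
    rw [← hs] at t1 t2
    have e1 := dif_smul_mem_fil y ha
    have e2 := dif_smul_mem_fil x hb
    have e3 := three_smul_mem_fil_three hxy h3 hXs
    have e4 := three_smul_mem_fil_three hxy h3 hYs
    have := sub_mem (sub_mem e3 e4) (add_mem e1 e2)
    convert this using 1
    rw [smul_sub, smul_sub, ← t1, ← t2]
    simp only [smul_add, smul_comm (dif x) b₁, smul_comm (dif x) b₂,
      smul_comm (dif y) a₁, smul_comm (dif y) a₂, smul_comm (dif y) (dif x), add_smul, sub_smul,
      one_smul, smul_neg]
    abel
  have hfil2 : ∀ g h : G, dif g • dif h • s ∈ fil G 2 := fun g h =>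
    dif_smul_mem_fil g (dif_smul_mem_fil h (mem_fil_zero _))
  have h33 : ∀ g h : G, (3 : ℤ) • dif g • dif h • s ∈ (fil G 3).toAddSubgroup := fun g h => by
    have := three_smul_mem_fil_three hxy h3 (fil_antitone one_le_two (hfil2 g h))
    rw [← Int.cast_smul_eq_zsmul (AbGroupRing G)]
    exact_mod_cast this
  -- A minor that is nonzero mod 3 would make γ_4/γ_5 cyclic, generated by the remaining one of XXs,
  -- XYs, YYs.
  have minor : ∀ {c₁ c₂ c₃ d₁ d₂ d₃ : ℤ},
      c₁ • dif x • dif x • s + c₂ • dif x • dif y • s + c₃ • dif y • dif y • s ∈ fil G 3 →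
      d₁ • dif x • dif x • s + d₂ • dif x • dif y • s + d₃ • dif y • dif y • s ∈ fil G 3 →
      ((c₁ * d₂ - c₂ * d₁ : ℤ) : ZMod 3) = 0 ∧ ((c₁ * d₃ - c₃ * d₁ : ℤ) : ZMod 3) = 0 ∧
        ((c₂ * d₃ - c₃ * d₂ : ℤ) : ZMod 3) = 0 := by
    intro c₁ c₂ c₃ d₁ d₂ d₃ hc hd
    refine ⟨?_, ?_, ?_⟩ <;> by_contra hdet <;>
      rw [ZMod.intCast_zmod_eq_zero_iff_dvd] at hdet <;> refine hnc ?_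
    · exact ⟨_, hfil2 y y, exists_int_sub_smul_mem (P := (fil G 2).toAddSubgroup) (h33 x x) (h33 x y)
        (fun t ht => exists_sub_mem_fil_three hxy ht) hc hd hdet⟩
    · refine ⟨_, hfil2 x y, exists_int_sub_smul_mem (P := (fil G 2).toAddSubgroup)
        (S := (fil G 3).toAddSubgroup) (a₃ := c₂) (b₃ := d₂) (h33 x x) (h33 y y)
        (fun t ht => ?_) ?_ ?_ hdet⟩
      · obtain ⟨n₁, n₂, n₃, h⟩ := exists_sub_mem_fil_three hxy ht
        exact ⟨n₁, n₃, n₂, by rwa [add_right_comm]⟩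
      · rwa [add_right_comm]
      · rwa [add_right_comm]
    · refine ⟨_, hfil2 x x, exists_int_sub_smul_mem (P := (fil G 2).toAddSubgroup)
        (S := (fil G 3).toAddSubgroup) (a₃ := c₁) (b₃ := d₁) (h33 x y) (h33 y y)
        (fun t ht => ?_) ?_ ?_ hdet⟩
      · obtain ⟨n₁, n₂, n₃, h⟩ := exists_sub_mem_fil_three hxy ht
        exact ⟨n₂, n₃, n₁, by rwa [add_comm (_ + _) (n₁ • _), ← add_assoc]⟩
      · rwa [add_comm, ← add_assoc]
      · rwa [add_comm, ← add_assoc]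
  obtain ⟨m1, m2, m3⟩ := minor r1 r2
  obtain ⟨m4, m5, m6⟩ := minor r1 r3
  obtain ⟨m7, m8, m9⟩ := minor r2 r3
  -- x, y, xy and xy² represent the four subgroups of order 3 in G/G', so any two of them generate
  -- G.
  have hxy' : pw hexp (x * y) - ((a₁ + b₁ + 1) • dif x • s + (a₂ + b₂ - 1) • dif y • s) ∈
      fil G 2 := by
    have := add_mem (pw_mul_sub_mem hexp h3 x y) (add_mem ha hb)
    convert this using 1
    rw [← hs]
    module
  have hxyy' : pw hexp (x * y * y) -
      ((a₁ + b₁ + 1 + b₁ + 1) • dif x • s + (a₂ + b₂ - 1 + b₂) • dif y • s) ∈ fil G 2 := by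
    have e1 : comm y (x * y) = s := by
      rw [comm_swap, comm_mul_left, hs, comm_swap y x]
      have : comm y y = 0 := by
        apply val_injective
        simp
      rw [this, smul_zero, zero_add]
    have e2 := dif_smul_mem_fil x hYs
    have := sub_mem (add_mem (pw_mul_sub_mem hexp h3 (x * y) y) (add_mem hxy' hb)) e2
    convert this using 1
    rw [e1, dif_mul, show grp x = 1 - dif x by simp [dif]]
    module
  have hmem1 : ∀ {z : DerivedModule G} {m n : ℤ}, z - (m • dif x • s + n • dif y • s) ∈ fil G 2 →
      z ∈ fil G 1 := by
    intro z m n h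
    have := add_mem (fil_antitone one_le_two h) (add_mem (zsmul_mem hXs m) (zsmul_mem hYs n))
    rwa [sub_add_cancel] at this
  have main : ∀ {g h : G} {u₁ u₂ v₁ v₂ : ℤ},
      pw hexp g - (u₁ • dif x • s + u₂ • dif y • s) ∈ fil G 2 →
      pw hexp h - (v₁ • dif x • s + v₂ • dif y • s) ∈ fil G 2 →
      ((u₁ * v₂ - u₂ * v₁ : ℤ) : ZMod 3) ≠ 0 →
      (x ∈ Subgroup.closure {g, h} ⊔ commutator G) →
      (y ∈ Subgroup.closure {g, h} ⊔ commutator G) →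
      ∃ g h : G, Subgroup.closure {g, h} = ⊤ ∧ pw hexp g ∈ fil G 1 ∧ pw hexp h ∈ fil G 1 ∧
        fil G 1 ≤ span (AbGroupRing G) {pw hexp g} ⊔ span (AbGroupRing G) {pw hexp h} := by
    intro g h u₁ u₂ v₁ v₂ hg hh hdet hxg hyg
    refine ⟨g, h, eq_top_of_sup_commutator (top_le_iff.1 ?_), hmem1 hg, hmem1 hh,
      fil_one_le_of_det hxy h3 hN hg hh hdet⟩
    rw [← hxy, Subgroup.closure_le]
    rintro _ (rfl | rfl)
    · exact hxg
    · exact hyg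
  have gen : ∀ g h : G, g ∈ Subgroup.closure {g, h} ⊔ commutator G ∧
      h ∈ Subgroup.closure {g, h} ⊔ commutator G := fun g h =>
    ⟨Subgroup.mem_sup_left (Subgroup.subset_closure (by simp)),
      Subgroup.mem_sup_left (Subgroup.subset_closure (by simp))⟩
  have det := exists_det_ne_zero a₁ a₂ b₁ b₂
  push_cast at m1 m2 m3 m4 m5 m6 m7 m8 m9
  rcases det m1 m2 m3 m4 m5 m6 m7 m8 m9 with d | d | d | d | d | d
  · exact main ha hb (by push_cast; exact d) (gen x y).1 (gen x y).2
  · refine main ha hxy' (by push_cast; exact d) (gen _ _).1 ?_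
    have := mul_mem (inv_mem (gen x (x * y)).1) (gen x (x * y)).2
    rwa [inv_mul_cancel_left] at this
  · refine main ha hxyy' (by push_cast; exact d) (gen _ _).1 ?_
    obtain ⟨g1, g2⟩ := gen x (x * y * y)
    have h1 := mul_mem (inv_mem g1) g2
    have h2 := mul_mem (mul_mem h1 h1) (inv_mem (Subgroup.mem_sup_right (hexp y)))
    convert h2 using 1
    group
  · refine main hb hxy' (by push_cast; exact d) ?_ (gen _ _).1
    have := mul_mem (gen y (x * y)).2 (inv_mem (gen y (x * y)).1)
    rwa [mul_inv_cancel_right] at this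
  · refine main hb hxyy' (by push_cast; exact d) ?_ (gen _ _).1
    have := mul_mem (mul_mem (gen y (x * y * y)).2 (inv_mem (gen y (x * y * y)).1))
      (inv_mem (gen y (x * y * y)).1)
    rwa [mul_inv_cancel_right, mul_inv_cancel_right] at this
  · obtain ⟨g1, g2⟩ := gen (x * y) (x * y * y)
    have hy' : y ∈ Subgroup.closure {x * y, x * y * y} ⊔ commutator G := by
      have := mul_mem (inv_mem g1) g2
      rwa [inv_mul_cancel_left] at this
    refine main hxy' hxyy' (by push_cast; exact d) ?_ hy'
    have := mul_mem g1 (inv_mem hy')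
    rwa [mul_inv_cancel_right] at this

end Three

end DerivedModule

end NormalLattice

/-! ### Lengths of the two chains and the count of submodules. -/

namespace NormalLattice

open Submodule

namespace DerivedModule

variable {G : Type*} [Group G] [IsMulCommutative (commutator G)]

theorem fil_eq_bot [Group.IsNilpotent G] {c : ℕ} (hc : Group.nilpotencyClass G = c)
    (hc1 : 1 ≤ c) : fil G (c - 1) = ⊥ := by
  apply toSubgroup_injective
  rw [toSubgroup_fil, show c - 1 + 2 = c + 1 by omega, gam_class_succ hc, eq_comm, eq_bot_iff]
  rintro _ ⟨z, hz, rfl⟩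
  rw [mem_bot] at hz
  simp [hz]

theorem dif_pow_smul_mem_fil (g : G) {z : DerivedModule G} {k : ℕ} (hz : z ∈ fil G k) (n : ℕ) :
    dif g ^ n • z ∈ fil G (k + n) := by
  induction n with
  | zero => simpa using hz
  | succ n ih =>
    rw [pow_succ', mul_smul, ← add_assoc]
    exact dif_smul_mem_fil g ih

theorem val_dif_pow_smul_comm (x y z : G) (n : ℕ) :
    (dif z ^ n • comm y x).val = iterComm x y z (n + 2) := by
  induction n with
  | zero => simp [iterComm]
  | succ n ih =>
    rw [pow_succ', mul_smul, val_dif_smul, ih]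
    simp only [iterComm, Nat.add_sub_cancel, Function.iterate_succ_apply']

theorem not_cyclic_fil (h : ¬ IsCyclic (gam G 4 ⧸ (gam G 5).subgroupOf (gam G 4))) :
    ¬ ∃ z ∈ fil G 2, ∀ t ∈ fil G 2, ∃ n : ℤ, t - n • z ∈ fil G 3 := by
  rintro ⟨z, hz, hgen⟩
  refine h ⟨QuotientGroup.mk ⟨z.val, ?_⟩, fun q => ?_⟩
  · rw [← toSubgroup_fil]
    exact val_mem_toSubgroup.2 hz
  · obtain ⟨⟨t', ht'⟩, rfl⟩ := QuotientGroup.mk_surjective q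
    have ht := ht'
    rw [← toSubgroup_fil] at ht
    obtain ⟨t, ht2, rfl⟩ := ht
    obtain ⟨n, hn⟩ := hgen t ht2
    refine ⟨n, ?_⟩
    change (_ : gam G 4 ⧸ (gam G 5).subgroupOf (gam G 4)) ^ n = _
    rw [← QuotientGroup.mk_zpow, QuotientGroup.eq, Subgroup.mem_subgroupOf, ← toSubgroup_fil]
    refine ⟨_, hn, ?_⟩
    have hval : ∀ (n : ℤ) (w : DerivedModule G), (n • w).val = w.val ^ n := by
      intro n w
      rfl
    rw [sub_eq_neg_add, val_add, val_neg, hval]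
    rfl

/-- The stabilizer of an element of the derived module under conjugation. -/
def stab (z : DerivedModule G) : Subgroup G where
  carrier := {g | grp g • z = z}
  mul_mem' := by
    intro g h hg hh
    change grp (g * h) • z = z
    rw [grp_mul, mul_smul, hh, hg]
  one_mem' := by
    change grp 1 • z = z
    rw [grp_one, one_smul]
  inv_mem' := by
    intro g hg
    change grp g⁻¹ • z = z
    nth_rewrite 1 [← show grp g • z = z from hg]
    rw [← mul_smul, ← grp_mul, inv_mul_cancel, grp_one, one_smul]

theorem mem_stab_iff {z : DerivedModule G} {g : G} : g ∈ stab z ↔ dif g • z = 0 := by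
  rw [dif, sub_smul, one_smul, sub_eq_zero, eq_comm]
  rfl

theorem commutator_le_stab (z : DerivedModule G) : commutator G ≤ stab z := by
  intro g hg
  change grp g • z = z
  rw [grp_of_mem hg, one_smul]

omit [IsMulCommutative (commutator G)] in
theorem exists_zpow_mul_zpow {g h : G} (hgh : Subgroup.closure {g, h} = ⊤) (k : G) :
    ∃ (m n : ℤ), ∃ a ∈ commutator G, k = g ^ m * h ^ n * a := by
  have hk : Abelianization.of k ∈
      Subgroup.closure {Abelianization.of g, Abelianization.of h} := by
    rw [← Set.image_pair, ← MonoidHom.map_closure, hgh]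
    exact Subgroup.mem_map_of_mem _ (Subgroup.mem_top k)
  obtain ⟨m, n, hmn⟩ := Subgroup.mem_closure_pair.1 hk
  refine ⟨m, n, (g ^ m * h ^ n)⁻¹ * k, ?_, by group⟩
  rw [← Abelianization.ker_of, MonoidHom.mem_ker]
  rw [map_mul, map_inv, map_mul, map_zpow, map_zpow, hmn, inv_mul_cancel]

omit [IsMulCommutative (commutator G)] in
theorem mem_of_zpow_mem {p : ℕ} (hp : p.Prime) {H : Subgroup G} {g : G} {m : ℤ}
    (hm : ¬ (p : ℤ) ∣ m) (h1 : g ^ m ∈ H) (h2 : g ^ p ∈ H) : g ∈ H := by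
  obtain ⟨a, b, hab⟩ := ((Nat.prime_iff_prime_int.1 hp).coprime_iff_not_dvd).2 hm
  have h3 := H.mul_mem (H.zpow_mem h2 a) (H.zpow_mem h1 b)
  rw [← zpow_natCast, ← zpow_mul, ← zpow_mul, ← zpow_add, mul_comm (p : ℤ), mul_comm m, hab,
    zpow_one] at h3
  exact h3

/-- Modulo G', k = g^m h^n with p not dividing both exponents. Stabilizers contain G', hence all
p-th powers, so a power prime to p that fixes an element forces its base to fix it. -/
theorem dif_smul_eq_zero_or {p : ℕ} (hp : p.Prime) (hexp : ∀ g : G, g ^ p ∈ commutator G)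
    {g h k : G} (hgh : Subgroup.closure {g, h} = ⊤) (hk : k ∉ commutator G)
    {z w : DerivedModule G} (hz : dif h • z = 0) (hw : dif g • w = 0) (hkz : dif k • z = 0)
    (hkw : dif k • w = 0) : dif g • z = 0 ∨ dif h • w = 0 := by
  obtain ⟨m, n, a, ha, rfl⟩ := exists_zpow_mul_zpow hgh k
  rw [← mem_stab_iff] at hz hw hkz hkw ⊢
  rw [← mem_stab_iff]
  have hkz' : g ^ m * h ^ n ∈ stab z :=
    ((stab z).mul_mem_cancel_right (commutator_le_stab z ha)).1 hkz
  have hkw' : g ^ m * h ^ n ∈ stab w :=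
    ((stab w).mul_mem_cancel_right (commutator_le_stab w ha)).1 hkw
  have hgz : g ^ m ∈ stab z := ((stab z).mul_mem_cancel_right ((stab z).zpow_mem hz n)).1 hkz'
  have hhw : h ^ n ∈ stab w := ((stab w).mul_mem_cancel_left ((stab w).zpow_mem hw m)).1 hkw'
  by_cases hm : (p : ℤ) ∣ m
  · by_cases hn : (p : ℤ) ∣ n
    · exfalso
      obtain ⟨m', rfl⟩ := hm
      obtain ⟨n', rfl⟩ := hn
      refine hk (mul_mem (mul_mem ?_ ?_) ha)
      · rw [zpow_mul, zpow_natCast]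
        exact zpow_mem (hexp g) m'
      · rw [zpow_mul, zpow_natCast]
        exact zpow_mem (hexp h) n'
    · exact Or.inr (mem_of_zpow_mem hp hn hhw (commutator_le_stab w (hexp h)))
  · exact Or.inl (mem_of_zpow_mem hp hm hgz (commutator_le_stab z (hexp g)))

section

variable {p c r : ℕ} [Fact p.Prime] [Finite G] [Group.IsNilpotent G]
  (hexp : ∀ g : G, g ^ p ∈ commutator G) (hc : Group.nilpotencyClass G = c) (hc2 : 2 ≤ c)
  (hr : 2 ≤ r) (hcard : Nat.card (commutator G) = p ^ (c + r - 2))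
include hexp hc hc2 hr hcard

/-- The count of submodules when `Y` annihilates `X • s`. -/
theorem card_submodule_of_chains {x y : G} (hxy : Subgroup.closure {x, y} = ⊤)
    (hyx : dif y • dif x • comm y x = 0) (hy : dif y ^ r • comm y x = 0) :
    Nat.card (Submodule (AbGroupRing G) (DerivedModule G)) =
      1 + (c - 2 + 1) * (r - 1 + 1) + (c - 2) * (r - 1) * (p - 1) := by
  have hN := fil_eq_bot (G := G) hc (by omega)
  have hu : dif x • comm y x ∈ fil G 1 := dif_smul_mem_fil x (mem_fil_zero _)
  have hv : dif y • comm y x ∈ fil G 1 := dif_smul_mem_fil y (mem_fil_zero _)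
  have hmul : ∀ g : G, (p : AbGroupRing G) • dif g • comm y x ∈
      span (AbGroupRing G) {dif g • dif g • comm y x} := by
    intro g
    obtain ⟨q, hq⟩ := exists_natCast_mul_dif hexp g
    exact mem_span_singleton.2 ⟨q, by rw [← mul_smul, ← mul_smul, ← mul_smul, hq, mul_assoc]⟩
  refine card_submodule hxy hexp hN hyx ?_ (hmul x) (hmul y) ?_ ?_ hu hv (fil_one_le hxy) ?_
  · rw [smul_comm, hyx]
  -- The chain starts in γ_3 and γ_{c+1} = 1, so it has at most c-2 steps.
  · have := dif_pow_smul_mem_fil x hu (c - 2)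
    rwa [show 1 + (c - 2) = c - 1 by omega, hN, mem_bot] at this
  · rwa [← mul_smul, ← pow_succ, show r - 1 + 1 = r by omega]
  · rw [card_eq, hcard]
    exact (congrArg _ (by omega)).le

omit hcard in
/-- The count of submodules for `p`-th powers of two generators generating `γ_3`. -/
theorem card_submodule_of_powers (hcard : Nat.card (commutator G) = p ^ (c + r - 2)) {x y : G}
    (hxy : Subgroup.closure {x, y} = ⊤)
    (hx1 : pw hexp x ∈ fil G 1) (hy1 : pw hexp y ∈ fil G 1)
    (hle : fil G 1 ≤ span (AbGroupRing G) {pw hexp x} ⊔ span (AbGroupRing G) {pw hexp y})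
    (hv : dif y ^ (r - 1) • pw hexp x = 0) :
    Nat.card (Submodule (AbGroupRing G) (DerivedModule G)) =
      1 + (c - 2 + 1) * (r - 1 + 1) + (c - 2) * (r - 1) * (p - 1) := by
  have hN := fil_eq_bot (G := G) hc (by omega)
  have hyx : Subgroup.closure {y, x} = ⊤ := by rwa [Set.pair_comm]
  refine card_submodule hxy hexp hN (dif_smul_pw_self hexp y) (dif_smul_pw_self hexp x)
    (natCast_smul_pw_mem hexp hxy) (natCast_smul_pw_mem hexp hyx) ?_ hv hy1 hx1
    (by rwa [sup_comm]) ?_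
  · have := dif_pow_smul_mem_fil x hy1 (c - 2)
    rwa [show 1 + (c - 2) = c - 1 by omega, hN, mem_bot] at this
  · rw [card_eq, hcard]
    exact (congrArg _ (by omega)).le

end

/-- The count of submodules for `p = 3` and vanishing defect. -/
theorem card_submodule_three {c r : ℕ} [Finite G] [Group.IsNilpotent G]
    (e : Abelianization G ≃* Multiplicative (ZMod 3 × ZMod 3))
    (hc : Group.nilpotencyClass G = c) (hc2 : 2 ≤ c) (hr : 2 ≤ r)
    (hG : Nat.card G = 3 ^ (c + r)) (hcard : Nat.card (commutator G) = 3 ^ (c + r - 2))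
    (hk : HasDefect G 0) :
    Nat.card (Submodule (AbGroupRing G) (DerivedModule G)) =
      1 + (c - 2 + 1) * (r - 1 + 1) + (c - 2) * (r - 1) * (3 - 1) := by
  have hexp : ∀ g : G, g ^ 3 ∈ commutator G := pow_mem_commutator e
  have hN := fil_eq_bot (G := G) hc (by omega)
  obtain ⟨k, hkc, hke⟩ := exists_centralizing hc hc2 hk
  have he2 := two_le_invE hc hc2
  have hke' : ∀ z ∈ fil G (invE G - 2), dif k • z = 0 := by
    intro z hz
    apply val_injective
    rw [val_dif_smul, val_zero]
    apply hke
    rw [show invE G = invE G - 2 + 2 by omega, ← toSubgroup_fil]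
    exact val_mem_toSubgroup.2 hz
  -- For e ≤ 3, `k` centralizes γ_3 and serves as the generator y.
  rcases le_or_gt (invE G) 3 with he | he
  · have hk1 : ∀ z ∈ fil G 1, dif k • z = 0 := fun z hz =>
      hke' z (fil_antitone (by omega) hz)
    obtain ⟨x, hx⟩ := exists_closure_pair_eq_top e hkc
    refine card_submodule_of_chains hexp hc hc2 hr hcard hx
      (hk1 _ (dif_smul_mem_fil x (mem_fil_zero _))) ?_
    rw [show r = (r - 1) + 1 by omega, pow_succ', mul_smul]
    refine hk1 _ (fil_antitone ?_ (dif_pow_smul_mem_fil k (mem_fil_zero _) (r - 1)))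
    omega
  -- The lower bound c-1+(e-2) for the exponent of |G'| is compared with its value c+r-2.
  · have her : invE G ≤ r + 1 := by
      have h1 := pow_le_card_gam_two hc hG hc2
      rw [gam_two, hcard] at h1
      have := (Nat.pow_le_pow_iff_right (by norm_num)).1 h1
      omega
    obtain ⟨x, y, hxy⟩ := exists_closure_pair_eq_top' e
    obtain ⟨g, h, hgh, hg1, hh1, hle⟩ := exists_generators_cubes hexp hxy hN
      (not_cyclic_fil (not_isCyclic_of_lt_invE (by omega) he))
    have hhg : Subgroup.closure {h, g} = ⊤ := by rwa [Set.pair_comm]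
    -- The cubes lie in γ_3, so e-3 further steps reach γ_e, where `k` acts trivially. One more step
    -- then kills one of the chains, after e-2 ≤ r-1 steps.
    have hz := dif_pow_smul_mem_fil g hh1 (invE G - 3)
    have hw := dif_pow_smul_mem_fil h hg1 (invE G - 3)
    rw [show 1 + (invE G - 3) = invE G - 2 by omega] at hz hw
    have hlift : ∀ {a b : G}, dif a • dif a ^ (invE G - 3) • pw hexp b = 0 →
        dif a ^ (r - 1) • pw hexp b = 0 := by
      intro a b hab
      rw [← mul_smul, ← pow_succ'] at hab
      rw [show r - 1 = (r - 1 - (invE G - 3 + 1)) + (invE G - 3 + 1) by omega, pow_add, mul_smul,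
        hab, smul_zero]
    rcases dif_smul_eq_zero_or Nat.prime_three hexp hgh hkc
      (by rw [smul_comm, dif_smul_pw_self, smul_zero])
      (by rw [smul_comm, dif_smul_pw_self, smul_zero]) (hke' _ hz) (hke' _ hw) with h1 | h1
    · exact card_submodule_of_powers hexp hc hc2 hr hcard hhg hh1 hg1 (by rwa [sup_comm]) (hlift h1)
    · exact card_submodule_of_powers hexp hc hc2 hr hcard hgh hg1 hh1 hle (hlift h1)

end DerivedModule

theorem card_commutator {G : Type*} [Group G] {p n : ℕ} [Fact p.Prime]
    (e : Abelianization G ≃* Multiplicative (ZMod p × ZMod p)) (hG : Nat.card G = p ^ n) :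
    2 ≤ n ∧ Nat.card (commutator G) = p ^ (n - 2) := by
  have hp := (Fact.out : p.Prime)
  have h1 : Nat.card G = p ^ 2 * Nat.card (commutator G) := by
    rw [← card_abelianization e]
    exact Subgroup.card_eq_card_quotient_mul_card_subgroup (commutator G)
  have h2 : 2 ≤ n := by
    rw [← Nat.pow_dvd_pow_iff_le_right hp.one_lt, ← hG]
    exact Dvd.intro _ h1.symm
  refine ⟨h2, Nat.eq_of_mul_eq_mul_left (pow_pos hp.pos 2) ?_⟩
  rw [← h1, hG, ← pow_add, Nat.add_sub_cancel' h2]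

end NormalLattice

/-! ### The total number of normal subgroups. -/

open NormalLattice in
theorem corollary6p4 {G : Type*} [Group G] (p c r : ℕ)
    (hp : p.Prime) (hodd : p ≠ 2)
    (hcard : Nat.card G = p ^ (c + r))
    (hc : Group.nilpotencyClass G = c)
    (hr : 2 ≤ r)
    (hab : Nonempty (Abelianization G ≃* Multiplicative (ZMod p × ZMod p)))
    (hmet : derivedSeries G 2 = ⊥)
    (hk : NormalLattice.HasDefect G 0)
    (hgen : p ≠ 3 → ∃ x y : G, NormalLattice.IndependentGenerators x y c r) :
    (Nat.card {N : Subgroup G // N.Normal} : ℤ)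
        = 1 + c + r + p * (3 + c * r - c - 2 * r) ∧
      (p = 3 → (Nat.card {N : Subgroup G // N.Normal} : ℤ)
        = 10 + 3 * c * r - 2 * c - 5 * r) := by
  have : Fact p.Prime := ⟨hp⟩
  obtain ⟨e⟩ := hab
  have : Finite G := Nat.finite_of_card_ne_zero (by rw [hcard]; exact pow_ne_zero _ hp.ne_zero)
  have : Group.IsNilpotent G := (IsPGroup.of_card hcard).isNilpotent
  have hcomm : IsMulCommutative (commutator G) := by
    refine IsMulCommutative.of_setLike_mul_comm fun a ha b hb => ?_
    have h1 : ⁅commutator G, commutator G⁆ = ⊥ := by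
      rwa [derivedSeries_succ, derivedSeries_one] at hmet
    have h2 := Subgroup.commutator_mem_commutator ha hb
    rw [h1, Subgroup.mem_bot] at h2
    exact commutatorElement_eq_one_iff_mul_comm.1 h2
  obtain ⟨-, hA⟩ := card_commutator e hcard
  -- Class at most 1 would give |G'| = 1, hence c + r = 2 and c = 0, so G would be trivial of order
  -- p².
  have hc2 : 2 ≤ c := by
    by_contra! hlt
    have h1 : commutator G = ⊥ := by
      have := gam_class_succ hc
      exact le_bot_iff.1 (this ▸ gam_antitone (G := G) (show c + 1 ≤ 2 by omega))
    rw [h1, Subgroup.card_bot, eq_comm, Nat.pow_eq_one] at hA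
    have hne := hp.one_lt
    have hc0 : c = 0 := by omega
    subst hc0
    have h3 : Subsingleton G := by
      have := gam_class_succ hc
      exact Subgroup.subsingleton_iff.1 (subsingleton_of_bot_eq_top this.symm)
    rw [Nat.card_eq_one_iff_unique.2 ⟨h3, ⟨1⟩⟩] at hcard
    exact absurd hcard.symm (Nat.one_lt_pow (by omega) hp.one_lt).ne'
  have key : Nat.card (Submodule (AbGroupRing G) (DerivedModule G)) =
      1 + (c - 2 + 1) * (r - 1 + 1) + (c - 2) * (r - 1) * (p - 1) := by
    by_cases hp3 : p = 3
    · subst hp3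
      exact DerivedModule.card_submodule_three e hc hc2 hr hcard hA hk
    · obtain ⟨x, y, hxy, h1, h2, -⟩ := hgen hp3
      refine DerivedModule.card_submodule_of_chains (pow_mem_commutator e) hc hc2 hr hA hxy ?_ ?_
      · apply DerivedModule.val_injective
        rw [DerivedModule.val_dif_smul, DerivedModule.val_zero, ← h1,
          ← DerivedModule.val_dif_pow_smul_comm x y x 1, pow_one]
      · apply DerivedModule.val_injective
        rw [DerivedModule.val_dif_pow_smul_comm, h2, DerivedModule.val_zero]
  have total := card_normal e
  rw [key] at total
  -- Writing c = a+2, r = b+1, p = q+1 removes the truncated subtractions.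
  obtain ⟨a, rfl⟩ := Nat.exists_eq_add_of_le' hc2
  obtain ⟨b, rfl⟩ := Nat.exists_eq_add_of_le' (show 1 ≤ r by omega)
  obtain ⟨q, rfl⟩ := Nat.exists_eq_add_of_le' hp.one_le
  simp only [Nat.add_sub_cancel] at total
  refine ⟨?_, fun h3 => ?_⟩
  · rw [total]
    push_cast
    ring
  · obtain rfl : q = 2 := by omega
    rw [total]
    push_cast
    ring
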